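/- Let $d\ge 2$ and $T\ge 1$, let $\theta^\star\in\mathbb R^d$ with $\|\theta^\star\|_2=1$, $\sigma\ge 0$ and $\beta\in\mathbb R$. LinUCB with the unit ball $\mathcal B^d=\{b\in\mathbb R^d:\|b\|_2\le 1\}$ as action set runs as follows. For $0\le t\le T$ put $$\Lambda_t=I_d+\sum_{s=1}^t a_sa_s^\top,\qquad \overline\theta_t=\Lambda_t^{-1}\sum_{s=1}^t r_s a_s,\qquad \widehat\theta_t=\mathcal P(\overline\theta_t),$$ where $\mathcal P(x)=x/\|x\|_2$ for $x\ne 0$ and $\mathcal P(0)$ is any fixed vector of norm at most $1$. In round $t=1,\dots,T$ the action is $$a_t\in\arg\max_{b\in\mathcal B^d}\Big\{\langle b,\widehat\theta_{t-1}\rangle+\beta\sqrt{b^\top\Lambda_{t-1}^{-1}b}\Big\},$$ chosen $\mathcal F_{t-1}$-measurably with $\mathcal F_t=\sigma(a_1,r_1,\dots,a_t,r_t)$, and the reward is $r_t=\langle a_t,\theta^\star\rangle+\epsilon_t$, where for $1\le t\le T$ and all $l\in\mathbb R$ $$\mathbb E[\epsilon_t\mid\mathcal F_{t-1}]=0,\qquad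 \mathrm{Var}[\epsilon_t\mid\mathcal F_{t-1}]=\sigma^2,\qquad \mathbb E[e^{l\epsilon_t}\mid\mathcal F_{t-1}]\le e^{\sigma^2l^2/2}.$$ Assume that $\beta$ is at least the radius of the standard confidence ellipsoid at level $1-1/T$: $$\beta\ \ge\ \sigma\sqrt{d\log(1+T/d)+2\log T}+1 .$$ Let $\lambda_{t,1}\ge\dots\ge\lambda_{t,d}$ be the eigenvalues of $\Lambda_t$, let $\overline\lambda_t=\frac1{d-1}\sum_{i=2}^d\lambda_{t,i}$, and let $v_{t,1}$ denote a unit eigenvector for $\lambda_{t,1}$ with the sign chosen such that $\langle v_{t,1},\theta^\star\rangle\ge 0$. Then for every $\kappa>0$ there are constants $c,C>0$, depending only on $\kappa$ (and not on $d,T,\sigma,\beta,\theta^\star$ or the law of the noise), such that with probability greater than $1-1/T$ the following hold simultaneously for all integers $t$ with $\kappa\beta^2d\le t\le T$ (in particular for all $t_1\le t\le T$ whenever $t_1\ge\kappa\beta^2d$, as for the end $t_1=\Theta(\beta^2d)$ of the initial exploration phase): $$c\,\overline\lambda_t\le\lambda_{t,d}\le C\,\overline\lambda_t,\qquad c\,\beta\sqrt{t/d}\le\overline\lambda_t\le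 C\,\beta\sqrt{t/d},$$ and every such leading eigenvector satisfies $$\|v_{t,1}-\theta^\star\|_2\le C\,\frac{\beta}{\sqrt{\lambda_{t,d}}}.$$ -/

import Mathlib

open MeasureTheory ProbabilityTheory
open scoped Matrix

noncomputable section

namespace LinUCB

/-- `ℝ^d` with the Euclidean norm. -/
abbrev Vec (d : ℕ) : Type := EuclideanSpace ℝ (Fin d)

/-- The regularized cumulative covariance matrix `Λ_t = I + ∑_{s=1}^t a_s a_sᵀ` of a sequence of
actions `a_1, a_2, …` (the entry `a 0` is not used). -/
def cov {d : ℕ} (a : ℕ → Vec d) (t : ℕ) : Matrix (Fin d) (Fin d) ℝ :=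
  1 + ∑ s ∈ Finset.Icc 1 t, Matrix.vecMulVec (WithLp.ofLp (a s)) (WithLp.ofLp (a s))

theorem cov_isHermitian {d : ℕ} (a : ℕ → Vec d) (t : ℕ) : (cov a t).IsHermitian := by
  unfold cov Matrix.IsHermitian
  rw [Matrix.conjTranspose_add, Matrix.conjTranspose_sum, Matrix.conjTranspose_one]
  congr 1
  refine Finset.sum_congr rfl fun s _ => ?_
  ext i j
  simp [Matrix.vecMulVec_apply, mul_comm]

/-- The ridge estimator `θ̄_t = Λ_t⁻¹ ∑_{s=1}^t r_s a_s` (regularization parameter `1`). -/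
def ridge {d : ℕ} (a : ℕ → Vec d) (r : ℕ → ℝ) (t : ℕ) : Vec d :=
  WithLp.toLp 2 ((cov a t)⁻¹ *ᵥ ∑ s ∈ Finset.Icc 1 t, r s • WithLp.ofLp (a s))

open Classical in
/-- Projection onto the unit sphere, `x ↦ x / ‖x‖` for `x ≠ 0`. At the origin, where the projection
is not defined by this formula, it takes the prescribed value `e`. -/
def sphereProj {d : ℕ} (e x : Vec d) : Vec d :=
  if x = 0 then e else ‖x‖⁻¹ • x

/-- `UCB_t(b) = ⟨b, θ̂_{t-1}⟩ + β √(bᵀ Λ_{t-1}⁻¹ b)`, where `θ̂_{t-1}` is the projection of the ridge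
estimator onto the unit sphere. -/
def ucb {d : ℕ} (β : ℝ) (e : Vec d) (a : ℕ → Vec d) (r : ℕ → ℝ) (t : ℕ) (b : Vec d) : ℝ :=
  inner ℝ b (sphereProj e (ridge a r (t - 1))) +
    β * √(WithLp.ofLp b ⬝ᵥ ((cov a (t - 1))⁻¹ *ᵥ WithLp.ofLp b))

/-- `λ_{t,i}`, `1 ≤ i ≤ d`: the eigenvalues of `Λ_t` with multiplicity, in non-increasing order. -/
def eig {d : ℕ} (a : ℕ → Vec d) (t i : ℕ) : ℝ :=
  if h : 1 ≤ i ∧ i ≤ d then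
    (cov_isHermitian a t).eigenvalues₀ ⟨i - 1, by rw [Fintype.card_fin]; omega⟩
  else 0

/-- `λ̄_t`: the mean of the non-leading eigenvalues `λ_{t,2}, …, λ_{t,d}`. -/
def meanEig {d : ℕ} (a : ℕ → Vec d) (t : ℕ) : ℝ :=
  (∑ i ∈ Finset.Icc 2 d, eig a t i) / ((d : ℝ) - 1)

/-- `v` is a leading eigenvector `v_{t,1}` of `Λ_t`: a unit eigenvector for `λ_{t,1}`, with its sign
chosen such that `⟨v, θ⟩ ≥ 0`. -/
def IsLeadingEigenvector {d : ℕ} (θ : Vec d) (a : ℕ → Vec d) (t : ℕ) (v : Vec d) : Prop :=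
  ‖v‖ = 1 ∧ cov a t *ᵥ WithLp.ofLp v = eig a t 1 • WithLp.ofLp v ∧ 0 ≤ inner ℝ v θ

/-- `x ≍ y` with explicit constants: `c y ≤ x ≤ C y`. -/
def Comparable (c C x y : ℝ) : Prop := c * y ≤ x ∧ x ≤ C * y

/-- The natural filtration `ℱ_t = σ(a_1, r_1, …, a_t, r_t)`. -/
@[reducible] def hist {Ω : Type*} {d : ℕ} (a : ℕ → Ω → Vec d) (r : ℕ → Ω → ℝ) (t : ℕ) : MeasurableSpace Ω :=
  ⨆ s ∈ Finset.Icc 1 t, MeasurableSpace.comap (a s) inferInstance ⊔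
    MeasurableSpace.comap (r s) inferInstance

/-- The noise `ε_t = r_t - ⟨a_t, θ⟩`, that is, `r_t = ⟨a_t, θ⟩ + ε_t`. -/
def noise {Ω : Type*} {d : ℕ} (θ : Vec d) (a : ℕ → Ω → Vec d) (r : ℕ → Ω → ℝ) (t : ℕ) : Ω → ℝ :=
  fun ω => r t ω - inner ℝ (a t ω) θ

/-- `(a_t, r_t)_{1 ≤ t ≤ T}` are the actions and rewards of LinUCB with exploration parameter `β` on
the unit ball of `ℝ^d`, in the linear model with parameter `θ` and conditionally sub-Gaussian
martingale difference noise of conditional variance `σ²`. -/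
structure IsRun {Ω : Type*} [MeasurableSpace Ω] (P : Measure Ω) {d : ℕ} (T : ℕ) (β σ : ℝ)
    (θ e : Vec d) (a : ℕ → Ω → Vec d) (r : ℕ → Ω → ℝ) : Prop where
  measurable_action : ∀ t ∈ Finset.Icc 1 T, Measurable (a t)
  measurable_reward : ∀ t ∈ Finset.Icc 1 T, Measurable (r t)
  predictable : ∀ t ∈ Finset.Icc 1 T, Measurable[hist a r (t - 1)] (a t)
  action_mem : ∀ t ∈ Finset.Icc 1 T, ∀ ω, ‖a t ω‖ ≤ 1
  action_max : ∀ t ∈ Finset.Icc 1 T, ∀ ω, ∀ b : Vec d, ‖b‖ ≤ 1 →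
    ucb β e (fun s => a s ω) (fun s => r s ω) t b ≤
      ucb β e (fun s => a s ω) (fun s => r s ω) t (a t ω)
  noise_mean : ∀ t ∈ Finset.Icc 1 T, P[noise θ a r t | hist a r (t - 1)] =ᵐ[P] 0
  noise_var : ∀ t ∈ Finset.Icc 1 T,
    condVar (hist a r (t - 1)) (noise θ a r t) P =ᵐ[P] fun _ => σ ^ 2
  noise_exp_integrable : ∀ t ∈ Finset.Icc 1 T, ∀ l : ℝ,
    Integrable (fun ω => Real.exp (l * noise θ a r t ω)) P
  noise_subgaussian : ∀ t ∈ Finset.Icc 1 T, ∀ l : ℝ,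
    P[fun ω => Real.exp (l * noise θ a r t ω) | hist a r (t - 1)] ≤ᵐ[P]
      fun _ => Real.exp (σ ^ 2 * l ^ 2 / 2)

end LinUCB

end

/-! On one event of probability above 1 - 1/T the ridge estimate lies within β/√λ of θ for all t ≤
T, where λ is the smallest eigenvalue of the current Λ (`exists_confidence_event`,
`norm_ridge_sub_le`). What remains is deterministic: on this event the run is `IsOptimistic`, so
each action maximizes its objective and lies within 4β/√λ of θ.

The heart is a lower bound on λ. Testing the maximizer against perturbations along the bottom
eigenvector forces aᵀΛ⁻¹a to be at least of order min(1/λ, β²/λ²) (`bonus_lower_bound`,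
`bonus_dichotomy`). Directions with eigenvalue much larger than λ cannot supply this: in them the
action is close to the mean of the n past actions, whose form is at most 1/n, and the deviation is
O(β/√λ). So squared length of order min(1, β²/λ) falls in eigendirections with eigenvalue O(λ)
(`explored_mass_ge`). Conversely, the trace of (1+ρ)(Λ+ρ)⁻¹ starts at d, never increases, and drops
by at least 1/(8ρ) times the mass that an action puts on eigenvalues ≤ ρ. Taking ρ of order λ over
t/2 rounds gives t·min(1, β²/λ) ≲ λd, that is, λ ≳ min(t/d, β√(t/d)) (`growth_le_minEig`). The proof
is an induction on t, since closeness to the mean rests on the bound at earlier times.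

Fed back into the distance bound, this yields ∑‖a_s - θ‖² ≲ β√(dt). The trace minus the Rayleigh
quotient at θ bounds the non-leading eigenvalues by this sum, so λ̄ ≲ β√(t/d), which matches the
lower bound once t ≥ κβ²d. The leading eigenvector follows from t‖v - θ‖ ≤ 8∑‖a_s - θ‖ and
Cauchy–Schwarz. -/

namespace LinUCB

/-! ### The covariance operator, its inverse and its spectrum -/

/-- The linear map `x ↦ Λ_t x`. -/
noncomputable def covLin {d : ℕ} (a : ℕ → Vec d) (t : ℕ) : Vec d →ₗ[ℝ] Vec d :=
  Matrix.toEuclideanLin (cov a t)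

/-- The linear map `x ↦ Λ_t⁻¹ x`. -/
noncomputable def covInv {d : ℕ} (a : ℕ → Vec d) (t : ℕ) : Vec d →ₗ[ℝ] Vec d :=
  Matrix.toEuclideanLin (cov a t)⁻¹

/-- The smallest eigenvalue of `Λ_t`. -/
noncomputable def minEig {d : ℕ} (a : ℕ → Vec d) (t : ℕ) : ℝ := eig a t d

theorem covLin_apply {d : ℕ} (a : ℕ → Vec d) (t : ℕ) (x : Vec d) :
    covLin a t x = x + ∑ s ∈ Finset.Icc 1 t, (inner ℝ (a s) x : ℝ) • a s := by
  ext i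
  simp only [covLin, Matrix.ofLp_toLpLin, Matrix.toLin'_apply, cov, Matrix.add_mulVec, Matrix.one_mulVec,
    Matrix.sum_mulVec, Matrix.vecMulVec_mulVec, Pi.add_apply, Finset.sum_apply, PiLp.add_apply,
    WithLp.ofLp_sum, WithLp.ofLp_smul, Pi.smul_apply, smul_eq_mul]
  congr 1
  refine Finset.sum_congr rfl fun s _ => ?_
  simp [EuclideanSpace.inner_eq_star_dotProduct, dotProduct_comm, mul_comm]

theorem inner_covLin {d : ℕ} (a : ℕ → Vec d) (t : ℕ) (x y : Vec d) :
    inner ℝ x (covLin a t y) =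
      inner ℝ x y + ∑ s ∈ Finset.Icc 1 t, inner ℝ (a s) x * inner ℝ (a s) y := by
  rw [covLin_apply, inner_add_right, inner_sum]
  congr 1
  refine Finset.sum_congr rfl fun s _ => ?_
  rw [inner_smul_right, real_inner_comm, mul_comm, real_inner_comm x]

theorem covLin_succ {d : ℕ} (a : ℕ → Vec d) (t : ℕ) (x : Vec d) :
    covLin a (t + 1) x = covLin a t x + (inner ℝ (a (t + 1)) x : ℝ) • a (t + 1) := by
  rw [covLin_apply, covLin_apply, Finset.sum_Icc_succ_top (by omega), add_assoc]

theorem inner_self_covLin_ge {d : ℕ} (a : ℕ → Vec d) (t : ℕ) (x : Vec d) :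
    ‖x‖ ^ 2 ≤ inner ℝ x (covLin a t x) := by
  rw [inner_covLin, real_inner_self_eq_norm_sq]
  have : 0 ≤ ∑ s ∈ Finset.Icc 1 t, inner ℝ (a s) x * inner ℝ (a s) x :=
    Finset.sum_nonneg fun s _ => mul_self_nonneg (inner ℝ (a s) x)
  linarith

theorem cov_posDef {d : ℕ} (a : ℕ → Vec d) (t : ℕ) : (cov a t).PosDef := by
  refine Matrix.PosDef.of_dotProduct_mulVec_pos (cov_isHermitian a t) fun x hx => ?_
  have h := inner_self_covLin_ge a t (WithLp.toLp 2 x)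
  have h2 : 0 < ‖WithLp.toLp 2 x‖ ^ 2 := by
    have : WithLp.toLp 2 x ≠ 0 := by simpa using hx
    positivity
  have h3 : inner ℝ (WithLp.toLp 2 x) (covLin a t (WithLp.toLp 2 x)) =
      star x ⬝ᵥ (cov a t *ᵥ x) := by
    rw [EuclideanSpace.inner_eq_star_dotProduct]
    simp [covLin, dotProduct_comm]
  linarith

theorem cov_isUnit_det {d : ℕ} (a : ℕ → Vec d) (t : ℕ) : IsUnit (cov a t).det :=
  (cov_posDef a t).det_pos.ne'.isUnit

theorem covLin_covInv {d : ℕ} (a : ℕ → Vec d) (t : ℕ) (x : Vec d) :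
    covLin a t (covInv a t x) = x := by
  ext i
  simp [covLin, covInv, Matrix.mulVec_mulVec, Matrix.mul_nonsing_inv _ (cov_isUnit_det a t)]

theorem covInv_covLin {d : ℕ} (a : ℕ → Vec d) (t : ℕ) (x : Vec d) :
    covInv a t (covLin a t x) = x := by
  ext i
  simp [covLin, covInv, Matrix.mulVec_mulVec, Matrix.nonsing_inv_mul _ (cov_isUnit_det a t)]

theorem covLin_symm {d : ℕ} (a : ℕ → Vec d) (t : ℕ) (x y : Vec d) :
    inner ℝ (covLin a t x) y = (inner ℝ x (covLin a t y) : ℝ) := by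
  rw [real_inner_comm, inner_covLin, inner_covLin, real_inner_comm]
  congr 1
  exact Finset.sum_congr rfl fun s _ => mul_comm _ _

theorem covInv_symm {d : ℕ} (a : ℕ → Vec d) (t : ℕ) (x y : Vec d) :
    inner ℝ (covInv a t x) y = (inner ℝ x (covInv a t y) : ℝ) := by
  conv_lhs => rw [← covLin_covInv a t y, ← covLin_symm, covLin_covInv]

theorem covInv_nonneg {d : ℕ} (a : ℕ → Vec d) (t : ℕ) (x : Vec d) :
    0 ≤ (inner ℝ x (covInv a t x) : ℝ) := by
  conv_rhs => rw [← covLin_covInv a t x, covInv_covLin, covLin_symm]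
  exact le_trans (by positivity) (inner_self_covLin_ge a t _)

theorem covInv_pos {d : ℕ} (a : ℕ → Vec d) (t : ℕ) {x : Vec d} (hx : x ≠ 0) :
    0 < (inner ℝ x (covInv a t x) : ℝ) := by
  conv_rhs => rw [← covLin_covInv a t x, covInv_covLin, covLin_symm]
  have : covInv a t x ≠ 0 := fun h => hx (by rw [← covLin_covInv a t x, h, map_zero])
  exact lt_of_lt_of_le (by positivity) (inner_self_covLin_ge a t _)

theorem ucb_eq {d : ℕ} (β : ℝ) (e : Vec d) (a : ℕ → Vec d) (r : ℕ → ℝ) (t : ℕ) (b : Vec d) :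
    ucb β e a r t b = inner ℝ b (sphereProj e (ridge a r (t - 1))) +
      β * √(inner ℝ b (covInv a (t - 1) b)) := by
  unfold ucb
  congr 3
  rw [EuclideanSpace.inner_eq_star_dotProduct]
  simp [covInv, dotProduct_comm]

theorem ridge_eq {d : ℕ} (a : ℕ → Vec d) (r : ℕ → ℝ) (t : ℕ) :
    ridge a r t = covInv a t (∑ s ∈ Finset.Icc 1 t, r s • a s) := by
  unfold ridge covInv
  rw [Matrix.toLpLin_apply]
  simp

/-- Spectral data of `Λ_t`. -/
theorem exists_eigenbasis {d : ℕ} (a : ℕ → Vec d) (t : ℕ) :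
    ∃ (b : OrthonormalBasis (Fin d) ℝ (Vec d)) (l : Fin d → ℝ),
      (∀ i, covLin a t (b i) = l i • b i) ∧
      (∀ i : Fin d, l i = eig a t (i + 1)) ∧ Antitone l := by
  have hc : Fintype.card (Fin d) = d := Fintype.card_fin d
  refine ⟨(cov_isHermitian a t).eigenvectorBasis.reindex
      (((Fintype.equivOfCardEq (Fintype.card_fin _)).symm).trans (finCongr hc)),
    fun i => (cov_isHermitian a t).eigenvalues₀ ((finCongr hc).symm i), ?_, ?_, ?_⟩
  · intro i
    rw [OrthonormalBasis.reindex_apply]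
    have h := (cov_isHermitian a t).mulVec_eigenvectorBasis
      ((Fintype.equivOfCardEq (Fintype.card_fin _)) ((finCongr hc).symm i))
    rw [Matrix.IsHermitian.eigenvalues, Equiv.symm_apply_apply] at h
    ext j
    have hj := congrFun h j
    simpa [covLin] using hj
  · intro i
    rw [eig, dif_pos ⟨by omega, by omega⟩]
    congr 1
  · intro i j hij
    exact (cov_isHermitian a t).eigenvalues₀_antitone hij

theorem eigenvalue_ge_one {d : ℕ} {a : ℕ → Vec d} {t : ℕ} {v : Vec d} {l : ℝ} (hv : ‖v‖ = 1)
    (h : covLin a t v = l • v) : 1 ≤ l := by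
  have := inner_self_covLin_ge a t v
  rw [h, inner_smul_right, real_inner_self_eq_norm_sq, hv] at this
  linarith

theorem covInv_eigenvector {d : ℕ} {a : ℕ → Vec d} {t : ℕ} {v : Vec d} {l : ℝ} (hl : l ≠ 0)
    (h : covLin a t v = l • v) : covInv a t v = l⁻¹ • v := by
  have := congrArg (covInv a t) h
  rw [covInv_covLin, map_smul] at this
  rw [eq_comm, inv_smul_eq_iff₀ hl]
  exact this

section Basis

variable {d : ℕ} {a : ℕ → Vec d} {t : ℕ} {b : OrthonormalBasis (Fin d) ℝ (Vec d)} {l : Fin d → ℝ}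

theorem inner_covLin_eq_sum (hb : ∀ i, covLin a t (b i) = l i • b i) (x : Vec d) :
    inner ℝ x (covLin a t x) = ∑ i, l i * (inner ℝ (b i) x) ^ 2 := by
  rw [← b.sum_inner_mul_inner]
  refine Finset.sum_congr rfl fun i _ => ?_
  rw [← covLin_symm, hb, inner_smul_left, real_inner_comm x]
  simp
  ring

theorem inner_covInv_eq_sum (hb : ∀ i, covLin a t (b i) = l i • b i) (hl : ∀ i, 1 ≤ l i)
    (x : Vec d) :
    inner ℝ x (covInv a t x) = ∑ i, (inner ℝ (b i) x) ^ 2 / l i := by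
  rw [← b.sum_inner_mul_inner]
  refine Finset.sum_congr rfl fun i _ => ?_
  have hi := hl i
  rw [← covInv_symm, covInv_eigenvector (by linarith) (hb i), inner_smul_left, real_inner_comm x]
  simp
  ring

theorem norm_sq_eq_sum (b : OrthonormalBasis (Fin d) ℝ (Vec d)) (x : Vec d) :
    ‖x‖ ^ 2 = ∑ i, (inner ℝ (b i) x) ^ 2 := by
  rw [← real_inner_self_eq_norm_sq, ← b.sum_inner_mul_inner]
  refine Finset.sum_congr rfl fun i _ => ?_
  rw [real_inner_comm x, sq]

theorem sum_eigenvalues (hb : ∀ i, covLin a t (b i) = l i • b i) :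
    ∑ i, l i = d + ∑ s ∈ Finset.Icc 1 t, ‖a s‖ ^ 2 := by
  have h : ∀ i, l i = 1 + ∑ s ∈ Finset.Icc 1 t, (inner ℝ (b i) (a s)) ^ 2 := by
    intro i
    have h1 := inner_covLin a t (b i) (b i)
    rw [hb, inner_smul_right, real_inner_self_eq_norm_sq, b.norm_eq_one] at h1
    simp only [one_pow, mul_one] at h1
    rw [h1]
    congr 1
    refine Finset.sum_congr rfl fun s _ => ?_
    rw [real_inner_comm, sq]
  rw [Finset.sum_congr rfl fun i _ => h i, Finset.sum_add_distrib, Finset.sum_comm]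
  simp [← norm_sq_eq_sum]

end Basis

theorem sum_eig {d : ℕ} {l : Fin d → ℝ} {a : ℕ → Vec d} {t : ℕ}
    (hl : ∀ i : Fin d, l i = eig a t (i + 1)) :
    ∑ i, l i = ∑ i ∈ Finset.Icc 1 d, eig a t i := by
  rw [Finset.sum_congr rfl fun i _ => hl i, Fin.sum_univ_eq_sum_range (fun i => eig a t (i + 1)),
    Finset.range_eq_Ico, Finset.sum_Ico_add' (fun i => eig a t i)]
  rfl

/-- Spectral data of `Λ_t` with the extreme eigenvalues singled out. -/
theorem exists_eigenbasis_extreme {d : ℕ} (hd : 1 ≤ d) (a : ℕ → Vec d) (t : ℕ) :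
    ∃ (b : OrthonormalBasis (Fin d) ℝ (Vec d)) (l : Fin d → ℝ) (j : Fin d),
      (∀ i, covLin a t (b i) = l i • b i) ∧ (∀ i, 1 ≤ l i) ∧ l j = minEig a t ∧
      (∀ i, minEig a t ≤ l i) ∧ (∀ i, l i ≤ eig a t 1) := by
  obtain ⟨b, l, hb, hl, hanti⟩ := exists_eigenbasis a t
  have hj : l ⟨d - 1, by omega⟩ = minEig a t := by
    rw [hl, minEig]
    congr 1
    simp only
    omega
  refine ⟨b, l, ⟨d - 1, by omega⟩, hb, fun i => eigenvalue_ge_one (b.norm_eq_one i) (hb i), hj,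
    fun i => ?_, fun i => ?_⟩
  · rw [← hj]
    apply hanti
    rw [Fin.le_def]
    simp only
    omega
  · have h0 : l ⟨0, by omega⟩ = eig a t 1 := by rw [hl]
    rw [← h0]
    apply hanti
    rw [Fin.le_def]
    simp

theorem minEig_ge_one {d : ℕ} (hd : 1 ≤ d) (a : ℕ → Vec d) (t : ℕ) : 1 ≤ minEig a t := by
  obtain ⟨b, l, j, -, hl, hj, -⟩ := exists_eigenbasis_extreme hd a t
  rw [← hj]
  exact hl j

theorem minEig_mul_le {d : ℕ} (hd : 1 ≤ d) (a : ℕ → Vec d) (t : ℕ) (x : Vec d) :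
    minEig a t * ‖x‖ ^ 2 ≤ inner ℝ x (covLin a t x) := by
  obtain ⟨b, l, j, hb, hl, hj, hmin, -⟩ := exists_eigenbasis_extreme hd a t
  rw [inner_covLin_eq_sum hb, norm_sq_eq_sum b, Finset.mul_sum]
  exact Finset.sum_le_sum fun i _ => mul_le_mul_of_nonneg_right (hmin i) (sq_nonneg _)

theorem le_maxEig_mul {d : ℕ} (hd : 1 ≤ d) (a : ℕ → Vec d) (t : ℕ) (x : Vec d) :
    inner ℝ x (covLin a t x) ≤ eig a t 1 * ‖x‖ ^ 2 := by
  obtain ⟨b, l, j, hb, hl, hj, -, hmax⟩ := exists_eigenbasis_extreme hd a t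
  rw [inner_covLin_eq_sum hb, norm_sq_eq_sum b, Finset.mul_sum]
  exact Finset.sum_le_sum fun i _ => mul_le_mul_of_nonneg_right (hmax i) (sq_nonneg _)

theorem covInv_le {d : ℕ} (hd : 1 ≤ d) (a : ℕ → Vec d) (t : ℕ) (x : Vec d) :
    inner ℝ x (covInv a t x) ≤ ‖x‖ ^ 2 / minEig a t := by
  obtain ⟨b, l, j, hb, hl, hj, hmin, -⟩ := exists_eigenbasis_extreme hd a t
  rw [inner_covInv_eq_sum hb hl, norm_sq_eq_sum b, Finset.sum_div]
  have := minEig_ge_one hd a t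
  exact Finset.sum_le_sum fun i _ => div_le_div_of_nonneg_left (sq_nonneg _) (by linarith) (hmin i)

theorem minEig_mono {d : ℕ} (hd : 1 ≤ d) (a : ℕ → Vec d) : Monotone (minEig a) := by
  refine monotone_nat_of_le_succ fun t => ?_
  obtain ⟨b, l, j, hb, hl, hj, -⟩ := exists_eigenbasis_extreme hd a (t + 1)
  have h := minEig_mul_le hd a t (b j)
  have h2 : inner ℝ (b j) (covLin a (t + 1) (b j)) = l j := by
    rw [hb, inner_smul_right, real_inner_self_eq_norm_sq, b.norm_eq_one]; simp
  rw [covLin_succ, inner_add_right, inner_smul_right, real_inner_comm] at h2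
  rw [b.norm_eq_one] at h
  have h3 := mul_self_nonneg (inner ℝ (b j) (a (t + 1)) : ℝ)
  rw [real_inner_comm] at h2
  simp only [real_inner_comm (a (t + 1)) (b j)] at *
  linarith

/-! ### Rank-one updates and the quadratic form of Λ⁻¹ -/

/-- The Sherman–Morrison formula for `Λ_{t+1}⁻¹`. -/
theorem covInv_succ {d : ℕ} (a : ℕ → Vec d) (t : ℕ) (x : Vec d) :
    covInv a (t + 1) x = covInv a t x -
      (inner ℝ (a (t + 1)) (covInv a t x) / (1 + inner ℝ (a (t + 1)) (covInv a t (a (t + 1))))) •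
        covInv a t (a (t + 1)) := by
  have hw := covInv_nonneg a t (a (t + 1))
  set w : ℝ := inner ℝ (a (t + 1)) (covInv a t (a (t + 1)))
  set u : ℝ := inner ℝ (a (t + 1)) (covInv a t x)
  have h : x = covLin a (t + 1) (covInv a t x - (u / (1 + w)) • covInv a t (a (t + 1))) := by
    rw [covLin_succ, map_sub, map_smul, covLin_covInv, covLin_covInv, inner_sub_right,
      inner_smul_right]
    have : u - u / (1 + w) * w = u / (1 + w) := by field_simp; ring
    change x = x - (u / (1 + w)) • a (t + 1) + (u - u / (1 + w) * w) • a (t + 1)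
    rw [this]; simp
  conv_lhs => rw [h, covInv_covLin]

/-- The quadratic form `x ↦ xᵀ Λ_t⁻¹ x`. -/
noncomputable def quad {d : ℕ} (a : ℕ → Vec d) (t : ℕ) (x : Vec d) : ℝ := inner ℝ x (covInv a t x)

theorem quad_nonneg {d : ℕ} (a : ℕ → Vec d) (t : ℕ) (x : Vec d) : 0 ≤ quad a t x :=
  covInv_nonneg a t x

theorem quad_smul {d : ℕ} (a : ℕ → Vec d) (t : ℕ) (k : ℝ) (x : Vec d) :
    quad a t (k • x) = k ^ 2 * quad a t x := by
  simp only [quad, map_smul, inner_smul_left, inner_smul_right]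
  simp
  ring

theorem quad_add_smul {d : ℕ} (a : ℕ → Vec d) (t : ℕ) (x y : Vec d) (k : ℝ) :
    quad a t (x + k • y) = quad a t x + 2 * k * inner ℝ y (covInv a t x) + k ^ 2 * quad a t y := by
  simp only [quad, map_add, map_smul, inner_smul_left, inner_smul_right, inner_add_left,
    inner_add_right]
  rw [← covInv_symm a t x y, real_inner_comm y]
  simp
  ring

theorem inner_covInv_sq_le {d : ℕ} (a : ℕ → Vec d) (t : ℕ) (x y : Vec d) :
    (inner ℝ x (covInv a t y)) ^ 2 ≤ quad a t x * quad a t y := by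
  by_cases hy : y = 0
  · simp [hy, quad]
  have hq : 0 < quad a t y := covInv_pos a t hy
  have h := quad_nonneg a t (y + (-(quad a t y / (inner ℝ x (covInv a t y)))) • x)
  by_cases hz : (inner ℝ x (covInv a t y) : ℝ) = 0
  · rw [hz]
    nlinarith [quad_nonneg a t x]
  rw [quad_add_smul] at h
  have h2 : 0 < (inner ℝ x (covInv a t y)) ^ 2 := by positivity
  have h3 : quad a t y + 2 * -(quad a t y / inner ℝ x (covInv a t y)) * inner ℝ x (covInv a t y) +
      (-(quad a t y / inner ℝ x (covInv a t y))) ^ 2 * quad a t x =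
      quad a t y / (inner ℝ x (covInv a t y)) ^ 2 *
        (quad a t x * quad a t y - (inner ℝ x (covInv a t y)) ^ 2) := by
    field_simp
    ring
  rw [h3] at h
  have h4 : 0 < quad a t y / (inner ℝ x (covInv a t y)) ^ 2 := by positivity
  have := nonneg_of_mul_nonneg_right h h4
  linarith

theorem sqrt_quad_add_le {d : ℕ} (a : ℕ → Vec d) (t : ℕ) (x y : Vec d) :
    √(quad a t (x + y)) ≤ √(quad a t x) + √(quad a t y) := by
  refine Real.sqrt_le_iff.2 ⟨by positivity, ?_⟩
  have h := quad_add_smul a t x y 1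
  have h1 := inner_covInv_sq_le a t y x
  have h2 : (inner ℝ y (covInv a t x) : ℝ) ≤ √(quad a t y) * √(quad a t x) := by
    rw [← Real.sqrt_mul (quad_nonneg a t y)]
    exact Real.le_sqrt_of_sq_le h1
  rw [one_smul] at h
  rw [h, add_sq, Real.sq_sqrt (quad_nonneg a t x), Real.sq_sqrt (quad_nonneg a t y)]
  linarith

/-! ### Optimality conditions for the chosen action -/

/-- The objective `b ↦ ⟨b, w⟩ + β √(bᵀ Λ_t⁻¹ b)`. -/
noncomputable def objective {d : ℕ} (β : ℝ) (a : ℕ → Vec d) (t : ℕ) (w b : Vec d) : ℝ :=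
  inner ℝ b w + β * √(quad a t b)

theorem objective_smul {d : ℕ} (β : ℝ) (a : ℕ → Vec d) (t : ℕ) (w b : Vec d) {k : ℝ}
    (hk : 0 ≤ k) : objective β a t w (k • b) = k * objective β a t w b := by
  unfold objective
  rw [quad_smul, Real.sqrt_mul (sq_nonneg k), Real.sqrt_sq hk, inner_smul_left]
  simp
  ring

section Maximizer

variable {d : ℕ} {β : ℝ} {a : ℕ → Vec d} {t : ℕ} {w α : Vec d}

/-- Positive homogeneity lets the maximizer be tested against vectors of any norm, without
renormalizing them. -/
theorem objective_le_mul_norm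
    (hmax : ∀ b : Vec d, ‖b‖ ≤ 1 → objective β a t w b ≤ objective β a t w α) (b : Vec d) :
    objective β a t w b ≤ objective β a t w α * ‖b‖ := by
  by_cases hb : b = 0
  · simp [hb, objective, quad]
  have hb' : 0 < ‖b‖ := norm_pos_iff.2 hb
  have h := hmax (‖b‖⁻¹ • b) (by rw [norm_smul]; simp [hb'.ne'])
  rw [objective_smul _ _ _ _ _ (by positivity), inv_mul_le_iff₀ hb'] at h
  linarith

theorem objective_maximizer_pos (hd : 1 ≤ d) (hβ : 0 < β)
    (hmax : ∀ b : Vec d, ‖b‖ ≤ 1 → objective β a t w b ≤ objective β a t w α) :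
    0 < objective β a t w α := by
  obtain ⟨b, l, j, -⟩ := exists_eigenbasis_extreme hd a t
  have h1 := hmax (b j) (b.norm_eq_one j).le
  have h2 := hmax (-(b j)) (by rw [norm_neg, b.norm_eq_one])
  have h3 : 0 < √(quad a t (b j)) := Real.sqrt_pos.2 (covInv_pos a t (b.orthonormal.ne_zero j))
  have h4 : quad a t (-(b j)) = quad a t (b j) := by
    have := quad_smul a t (-1) (b j)
    simpa using this
  have h5 : 0 < β * √(quad a t (b j)) := by positivity
  unfold objective at h1 h2 ⊢
  rw [h4, inner_neg_left] at h2
  linarith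

theorem norm_maximizer (hd : 1 ≤ d) (hβ : 0 < β) (hα : ‖α‖ ≤ 1)
    (hmax : ∀ b : Vec d, ‖b‖ ≤ 1 → objective β a t w b ≤ objective β a t w α) : ‖α‖ = 1 := by
  have h1 := objective_le_mul_norm hmax α
  have h2 := objective_maximizer_pos hd hβ hmax
  nlinarith

/-- First-order optimality. -/
theorem gradient_maximizer (hd : 1 ≤ d) (hβ : 0 < β) (hα : ‖α‖ ≤ 1)
    (hmax : ∀ b : Vec d, ‖b‖ ≤ 1 → objective β a t w b ≤ objective β a t w α) :
    w + (β / √(quad a t α)) • covInv a t α = objective β a t w α • α := by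
  have hα1 := norm_maximizer hd hβ hα hmax
  have hα0 : α ≠ 0 := norm_ne_zero_iff.1 (by rw [hα1]; norm_num)
  set s := √(quad a t α) with hs
  have hs0 : 0 < s := Real.sqrt_pos.2 (covInv_pos a t hα0)
  have hs2 : s ^ 2 = quad a t α := Real.sq_sqrt (quad_nonneg a t α)
  set μ := objective β a t w α with hμ
  set g := w + (β / s) • covInv a t α with hg
  -- By Cauchy–Schwarz for the Λ⁻¹ form, `g` is a supporting functional of the convex objective,
  -- with equality at `α`. Testing at `g` itself then gives ‖g‖ ≤ μ, so ⟨α, g⟩ = μ is the equality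
  -- case of Cauchy–Schwarz and g = μα.
  have hle : ∀ b : Vec d, inner ℝ b g ≤ objective β a t w b := by
    intro b
    have h1 : (inner ℝ b (covInv a t α) : ℝ) ≤ √(quad a t b) * s := by
      rw [hs, ← Real.sqrt_mul (quad_nonneg a t b)]
      exact Real.le_sqrt_of_sq_le (inner_covInv_sq_le a t b α)
    rw [hg, inner_add_right, inner_smul_right, objective]
    have h2 : β / s * inner ℝ b (covInv a t α) ≤ β / s * (√(quad a t b) * s) := by gcongr
    have h3 : β / s * (√(quad a t b) * s) = β * √(quad a t b) := by field_simp
    linarith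
  have hαg : inner ℝ α g = μ := by
    rw [hg, inner_add_right, inner_smul_right, hμ, objective, ← hs]
    change inner ℝ α w + β / s * quad a t α = _
    rw [← hs2]
    field_simp
  have hμ0 : 0 < μ := objective_maximizer_pos hd hβ hmax
  have hgn : ‖g‖ ≤ μ := by
    have h1 := (hle g).trans (objective_le_mul_norm hmax g)
    rw [real_inner_self_eq_norm_sq] at h1
    by_contra hcon
    push Not at hcon
    nlinarith
  have h0 : ‖g - μ • α‖ ^ 2 ≤ 0 := by
    rw [norm_sub_sq_real, inner_smul_right, real_inner_comm, hαg, norm_smul, hα1,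
      Real.norm_of_nonneg hμ0.le]
    nlinarith [norm_nonneg g]
  have : g - μ • α = 0 := by
    rw [← norm_eq_zero]
    exact pow_eq_zero_iff two_ne_zero |>.1 (le_antisymm h0 (sq_nonneg _))
  exact sub_eq_zero.1 this

/-- Second-order optimality: the exploration bonus of the maximizer is large. -/
theorem bonus_lower_bound (hd : 1 ≤ d) (hβ : 0 < β) (hα : ‖α‖ ≤ 1)
    (hmax : ∀ b : Vec d, ‖b‖ ≤ 1 → objective β a t w b ≤ objective β a t w α) :
    4 / 5 * β ≤ minEig a t * objective β a t w α * √(quad a t α) := by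
  have hα1 := norm_maximizer hd hβ hα hmax
  have hα0 : α ≠ 0 := norm_ne_zero_iff.1 (by rw [hα1]; norm_num)
  have hgrad := gradient_maximizer hd hβ hα hmax
  have hhom := objective_le_mul_norm hmax
  set s := √(quad a t α) with hs
  have hs0 : 0 < s := Real.sqrt_pos.2 (covInv_pos a t hα0)
  have hs2 : s ^ 2 = quad a t α := Real.sq_sqrt (quad_nonneg a t α)
  have hμ0 : 0 < objective β a t w α := objective_maximizer_pos hd hβ hmax
  set μ := objective β a t w α with hμ
  obtain ⟨b, l, j, hb, hl, hj, -⟩ := exists_eigenbasis_extreme hd a t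
  set L := minEig a t with hL
  have hL1 : 1 ≤ L := by rw [← hj]; exact hl j
  have hL0 : 0 < L := by linarith
  set v := b j with hv
  have hv1 : ‖v‖ = 1 := b.norm_eq_one j
  have hVv : covInv a t v = L⁻¹ • v := covInv_eigenvector hL0.ne' (by rw [hb, hj])
  set p : ℝ := inner ℝ v α with hp
  have hvVα : inner ℝ v (covInv a t α) = p / L := by
    rw [← covInv_symm, hVv, inner_smul_left, hp]
    simp
    ring
  have hqv : quad a t v = 1 / L := by
    rw [quad, hVv, inner_smul_right, real_inner_self_eq_norm_sq, hv1]
    simp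
  have hw : w = μ • α - (β / s) • covInv a t α := by rw [← hgrad]; simp
  have hvw : inner ℝ v w = μ * p - β / s * (p / L) := by
    rw [hw, inner_sub_right, inner_smul_right, inner_smul_right, hvVα]
  have hαw : inner ℝ α w = μ - β * s := by
    rw [hμ, objective, ← hs]; ring
  -- Homogeneous optimality at α + x v, with v the bottom eigenvector; everything is explicit in p =
  -- ⟨v, α⟩.
  have key : ∀ x : ℝ, μ - β * s + x * (μ * p - β / s * (p / L)) +
      β * √(s ^ 2 + 2 * x * (p / L) + x ^ 2 * (1 / L)) ≤ μ * √(1 + 2 * x * p + x ^ 2) := by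
    intro x
    have h := hhom (α + x • v)
    rw [objective, quad_add_smul, inner_add_left, inner_smul_left, hvw, hαw, hqv, hvVα, ← hs2] at h
    have hn : ‖α + x • v‖ = √(1 + 2 * x * p + x ^ 2) := by
      rw [← Real.sqrt_sq (norm_nonneg (α + x • v)), norm_add_sq_real, inner_smul_right, norm_smul,
        hα1, hv1, real_inner_comm]
      congr 1
      simp
      ring
    rw [hn] at h
    simpa using h
  by_cases hp0 : p = 0
  -- For p = 0 this x doubles the form, so the bonus gains (√2 - 1)βs ≥ (2/5)βs, while the norm
  -- costs at most μLs²/2.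
  · have h := key (√L * s)
    rw [hp0] at h
    have e1 : s ^ 2 + 2 * (√L * s) * (0 / L) + (√L * s) ^ 2 * (1 / L) = s ^ 2 * 2 := by
      rw [mul_pow, Real.sq_sqrt hL0.le]
      field_simp
      ring
    have e2 : √(1 + 2 * (√L * s) * 0 + (√L * s) ^ 2) ≤ 1 + L * s ^ 2 / 2 := by
      rw [mul_pow, Real.sq_sqrt hL0.le]
      refine Real.sqrt_le_iff.2 ⟨by positivity, ?_⟩
      nlinarith [sq_nonneg (L * s ^ 2)]
    rw [e1, Real.sqrt_mul (sq_nonneg s), Real.sqrt_sq hs0.le] at h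
    have e3 : (7 / 5 : ℝ) ≤ √2 := Real.le_sqrt_of_sq_le (by norm_num)
    have e4 : μ * √(1 + 2 * (√L * s) * 0 + (√L * s) ^ 2) ≤ μ * (1 + L * s ^ 2 / 2) := by gcongr
    have e5 : β * (s * (7 / 5)) ≤ β * (s * √2) := by gcongr
    have e6 : s * (4 / 5 * β) ≤ s * (L * μ * s) := by
      simp only [mul_zero, zero_div, sub_zero, add_zero] at h e4
      linarith
    exact le_of_mul_le_mul_left e6 hs0
  -- For p ≠ 0 reflect α in the hyperplane orthogonal to v: norm and bonus are unchanged, so only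
  -- the linear term is compared.
  · have h := key (-(2 * p))
    have e1 : s ^ 2 + 2 * -(2 * p) * (p / L) + (-(2 * p)) ^ 2 * (1 / L) = s ^ 2 := by
      field_simp
      ring
    have e2 : 1 + 2 * -(2 * p) * p + (-(2 * p)) ^ 2 = 1 := by ring
    rw [e1, e2, Real.sqrt_one, Real.sqrt_sq hs0.le] at h
    have hp2 : 0 < 2 * p ^ 2 := by positivity
    have e3 : 2 * p ^ 2 * (β / s * (1 / L)) ≤ 2 * p ^ 2 * μ := by
      have : -(2 * p) * (μ * p - β / s * (p / L)) =
        2 * p ^ 2 * (β / s * (1 / L)) - 2 * p ^ 2 * μ := by ring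
      linarith
    have e4 := le_of_mul_le_mul_left e3 hp2
    have e5 : β = L * (β / s * (1 / L)) * s := by field_simp
    have e6 : L * (β / s * (1 / L)) * s ≤ L * μ * s := by gcongr
    linarith

end Maximizer

/-! ### The trace potential and past means -/

section Potential

variable {d : ℕ}

theorem quad_succ (a : ℕ → Vec d) (t : ℕ) (x : Vec d) :
    quad a (t + 1) x = quad a t x -
      (inner ℝ (a (t + 1)) (covInv a t x)) ^ 2 / (1 + quad a t (a (t + 1))) := by
  rw [quad, covInv_succ, inner_sub_right, inner_smul_right, ← covInv_symm a t x (a (t + 1)),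
    real_inner_comm (a (t + 1)) (covInv a t x)]
  simp only [quad]
  ring

theorem covInv_zero (a : ℕ → Vec d) (x : Vec d) : covInv a 0 x = x := by
  have h : covLin a 0 x = x := by simp [covLin_apply]
  conv_lhs => rw [← h, covInv_covLin]

/-- Telescoping of the trace of `Λ_t⁻¹`. -/
theorem sum_trace_decrease_le (a : ℕ → Vec d) (N : ℕ) :
    ∑ n ∈ Finset.range N, ‖covInv a n (a (n + 1))‖ ^ 2 / (1 + quad a n (a (n + 1))) ≤ (d : ℝ) := by
  set c := EuclideanSpace.basisFun (Fin d) ℝ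
  have h : ∀ n, ‖covInv a n (a (n + 1))‖ ^ 2 / (1 + quad a n (a (n + 1))) =
      ∑ i, quad a n (c i) - ∑ i, quad a (n + 1) (c i) := by
    intro n
    rw [← Finset.sum_sub_distrib, norm_sq_eq_sum c, Finset.sum_div]
    refine Finset.sum_congr rfl fun i _ => ?_
    rw [quad_succ, ← covInv_symm, real_inner_comm]
    ring
  rw [Finset.sum_congr rfl fun n _ => h n, Finset.sum_range_sub']
  have h0 : ∑ i, quad a 0 (c i) = d := by
    simp [quad, covInv_zero]
  have h1 : 0 ≤ ∑ i, quad a N (c i) := Finset.sum_nonneg fun i _ => quad_nonneg a N _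
  linarith

/-- Shrinking the actions changes the effective regularization: results proved for Λ apply to (Λ +
ρ)/(1 + ρ), whose inverse barely sees eigenvalues far above ρ. -/
theorem covLin_scale (a : ℕ → Vec d) (t : ℕ) {ρ : ℝ} (hρ : 0 ≤ ρ) (x : Vec d) :
    covLin (fun s => (√(1 + ρ))⁻¹ • a s) t x = (1 + ρ)⁻¹ • (covLin a t x + ρ • x) := by
  have h1 : (1 + ρ) ≠ 0 := by positivity
  rw [covLin_apply, covLin_apply, eq_inv_smul_iff₀ h1, smul_add, Finset.smul_sum, add_smul 1 ρ x,
    one_smul, add_right_comm x]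
  congr 2
  refine Finset.sum_congr rfl fun s _ => ?_
  rw [inner_smul_left, smul_smul, smul_smul]
  congr 1
  have h2 : √(1 + ρ) * √(1 + ρ) = 1 + ρ := Real.mul_self_sqrt (by positivity)
  have h3 : √(1 + ρ) ≠ 0 := by positivity
  simp only [map_inv₀, conj_trivial]
  field_simp
  rw [pow_two, h2]

variable {a : ℕ → Vec d} {t : ℕ} {b : OrthonormalBasis (Fin d) ℝ (Vec d)} {l : Fin d → ℝ}

/-- The right side is the one-step trace decrease for the rescaled actions. In 8ρ, a factor 4 comes
from (l + ρ)² ≤ 4ρ² and a factor 2 from the denominator 1 + quad ≤ 2. -/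
theorem small_mass_le (hb : ∀ i, covLin a t (b i) = l i • b i) (hl : ∀ i, 1 ≤ l i) {ρ : ℝ}
    (hρ : 1 ≤ ρ) (hd : 1 ≤ d) (ha : ‖a (t + 1)‖ ≤ 1) :
    (∑ i with l i ≤ ρ, (inner ℝ (b i) (a (t + 1))) ^ 2) / (8 * ρ) ≤
      ‖covInv (fun s => (√(1 + ρ))⁻¹ • a s) t ((√(1 + ρ))⁻¹ • a (t + 1))‖ ^ 2 /
        (1 + quad (fun s => (√(1 + ρ))⁻¹ • a s) t ((√(1 + ρ))⁻¹ • a (t + 1))) := by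
  set a' : ℕ → Vec d := fun s => (√(1 + ρ))⁻¹ • a s with ha'
  have hρ0 : 0 < ρ := by linarith
  have hsq : √(1 + ρ) * √(1 + ρ) = 1 + ρ := Real.mul_self_sqrt (by positivity)
  have hb' : ∀ i, covLin a' t (b i) = ((l i + ρ) / (1 + ρ)) • b i := by
    intro i
    rw [ha', covLin_scale a t hρ0.le, hb, ← add_smul, smul_smul]
    congr 1
    ring
  have hq1 : quad a' t (a' (t + 1)) ≤ 1 := by
    have h1 := covInv_le hd a' t (a' (t + 1))
    have h2 := minEig_ge_one hd a' t
    have h3 : ‖a' (t + 1)‖ ≤ 1 := by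
      rw [ha', norm_smul, norm_inv, Real.norm_of_nonneg (Real.sqrt_nonneg _)]
      have : 1 ≤ √(1 + ρ) := Real.one_le_sqrt.2 (by linarith)
      exact mul_le_one₀ (inv_le_one_of_one_le₀ this) (norm_nonneg _) ha
    refine h1.trans (div_le_one_of_le₀ ?_ (by linarith))
    nlinarith [norm_nonneg (a' (t + 1))]
  have hq0 := quad_nonneg a' t (a' (t + 1))
  have hn : ‖covInv a' t (a' (t + 1))‖ ^ 2 =
      ∑ i, (1 + ρ) / (l i + ρ) ^ 2 * (inner ℝ (b i) (a (t + 1))) ^ 2 := by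
    rw [norm_sq_eq_sum b]
    refine Finset.sum_congr rfl fun i _ => ?_
    have hi := hl i
    rw [← covInv_symm, covInv_eigenvector (by positivity) (hb' i), inner_smul_left, ha',
      inner_smul_right]
    simp only [conj_trivial]
    rw [mul_pow, mul_pow, inv_pow, inv_pow, Real.sq_sqrt (by positivity)]
    field_simp
  have hmass : (∑ i with l i ≤ ρ, (inner ℝ (b i) (a (t + 1))) ^ 2) / (4 * ρ) ≤
      ‖covInv a' t (a' (t + 1))‖ ^ 2 := by
    rw [hn, Finset.sum_div]
    refine le_trans (Finset.sum_le_sum (g := fun i => (1 + ρ) / (l i + ρ) ^ 2 *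
      (inner ℝ (b i) (a (t + 1))) ^ 2) fun i hi => ?_)
      (Finset.sum_le_univ_sum_of_nonneg fun i => by positivity)
    have hi' : l i ≤ ρ := (Finset.mem_filter.1 hi).2
    have h1 := hl i
    have h2 : 1 / (4 * ρ) ≤ (1 + ρ) / (l i + ρ) ^ 2 := by
      rw [div_le_div_iff₀ (by positivity) (by positivity)]
      nlinarith
    calc _ = 1 / (4 * ρ) * (inner ℝ (b i) (a (t + 1))) ^ 2 := by ring
      _ ≤ _ := by gcongr
  change _ ≤ ‖covInv a' t (a' (t + 1))‖ ^ 2 / (1 + quad a' t (a' (t + 1)))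
  calc _ = (∑ i with l i ≤ ρ, (inner ℝ (b i) (a (t + 1))) ^ 2) / (4 * ρ) / 2 := by
        rw [div_div]; congr 1; ring
    _ ≤ ‖covInv a' t (a' (t + 1))‖ ^ 2 / 2 := by gcongr
    _ ≤ _ := by gcongr; linarith

/-- Λ_n dominates ∑ a_s a_sᵀ, which dominates n m mᵀ for the mean m: the direction of the mean is
already well explored. -/
theorem quad_mean_le (a : ℕ → Vec d) {n : ℕ} (hn : 1 ≤ n) :
    quad a n ((n : ℝ)⁻¹ • ∑ s ∈ Finset.Icc 1 n, a s) ≤ 1 / n := by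
  set m := (n : ℝ)⁻¹ • ∑ s ∈ Finset.Icc 1 n, a s with hm
  set y := covInv a n m with hy
  have hn0 : (0 : ℝ) < n := by exact_mod_cast hn
  have h1 : quad a n m = (n : ℝ)⁻¹ * ∑ s ∈ Finset.Icc 1 n, inner ℝ (a s) y := by
    rw [quad, ← hy, hm, inner_smul_left, sum_inner]
    simp
  have h2 : ∑ s ∈ Finset.Icc 1 n, (inner ℝ (a s) y) ^ 2 ≤ quad a n m := by
    have h3 := inner_covLin a n y y
    rw [hy, covLin_covInv, ← hy, real_inner_self_eq_norm_sq, real_inner_comm] at h3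
    simp only [← sq] at h3
    have : 0 ≤ ‖y‖ ^ 2 := by positivity
    change _ ≤ (inner ℝ m y : ℝ)
    linarith
  have h3 : (∑ s ∈ Finset.Icc 1 n, inner ℝ (a s) y) ^ 2 ≤
      n * ∑ s ∈ Finset.Icc 1 n, (inner ℝ (a s) y : ℝ) ^ 2 := by
    have := sq_sum_le_card_mul_sum_sq (s := Finset.Icc 1 n) (f := fun s => (inner ℝ (a s) y : ℝ))
    simpa using this
  have h4 : (∑ s ∈ Finset.Icc 1 n, inner ℝ (a s) y) = n * quad a n m := by
    rw [h1]; field_simp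
  rw [h4] at h3
  have h5 : n * quad a n m * (n * quad a n m) ≤ n * quad a n m * 1 := by
    nlinarith
  rcases (quad_nonneg a n m).eq_or_lt with h0 | h0
  · rw [← h0]; positivity
  · have := le_of_mul_le_mul_left h5 (by positivity)
    rw [le_div_iff₀ hn0]
    linarith

end Potential

/-! ### How much an optimistic action explores -/

/-- The deterministic features of a run of an optimistic algorithm on the unit ball, at
indices up to `T`, that the spectral analysis needs. -/
structure IsOptimistic {d : ℕ} (β : ℝ) (θ : Vec d) (a : ℕ → Vec d) (T : ℕ) : Prop where
  norm_le : ∀ n < T, ‖a (n + 1)‖ ≤ 1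
  maximizes : ∀ n < T, ∃ w : Vec d, ‖w‖ ≤ 1 ∧ ∀ b : Vec d, ‖b‖ ≤ 1 →
    objective β a n w b ≤ objective β a n w (a (n + 1))
  dist_le : ∀ n < T, ‖a (n + 1) - θ‖ ≤ 4 * β / √(minEig a n)

section StepMass

variable {d : ℕ} {β : ℝ} {a : ℕ → Vec d} {t : ℕ} {θ : Vec d} {T : ℕ}

/-- The maximal value is at most 1 + βs with s the root of the form. Whichever of 1 and βs dominates
turns `bonus_lower_bound` into one of the two alternatives. -/
theorem bonus_dichotomy (hd : 1 ≤ d) (hβ : 0 < β) {w α : Vec d} (hw : ‖w‖ ≤ 1) (hα : ‖α‖ ≤ 1)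
    (hmax : ∀ b : Vec d, ‖b‖ ≤ 1 → objective β a t w b ≤ objective β a t w α) :
    2 / 5 / minEig a t ≤ quad a t α ∨ 4 / 25 * β ^ 2 / (minEig a t) ^ 2 ≤ quad a t α := by
  have h := bonus_lower_bound hd hβ hα hmax
  have hL := minEig_ge_one hd a t
  have hs2 : √(quad a t α) ^ 2 = quad a t α := Real.sq_sqrt (quad_nonneg a t α)
  have hs0 := Real.sqrt_nonneg (quad a t α)
  have hμ : objective β a t w α ≤ 1 + β * √(quad a t α) := by
    have h1 := real_inner_le_norm α w
    have h2 : ‖α‖ * ‖w‖ ≤ 1 := mul_le_one₀ hα (norm_nonneg _) hw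
    rw [objective]
    linarith
  set s := √(quad a t α)
  set L := minEig a t
  rw [← hs2]
  rcases le_total 1 (β * s) with h1 | h1
  · left
    rw [div_le_iff₀ (by linarith)]
    have h2 : L * objective β a t w α * s ≤ L * (2 * (β * s)) * s := by gcongr; linarith
    have h3 : β * (4 / 5) ≤ β * (2 * (s ^ 2 * L)) := by linarith
    have := le_of_mul_le_mul_left h3 hβ
    linarith
  · right
    rw [div_le_iff₀ (by positivity)]
    have h2 : L * objective β a t w α * s ≤ L * 2 * s := by gcongr; linarith
    have h3 : 2 / 5 * β ≤ L * s := by linarith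
    have h4 : (2 / 5 * β) ^ 2 ≤ (L * s) ^ 2 := by gcongr
    linarith

variable {b : OrthonormalBasis (Fin d) ℝ (Vec d)} {l : Fin d → ℝ}

/-- If the large eigenvalues carry at most half of the form, the small ones carry the rest, each
with weight at most 1/λ_min. -/
theorem small_mass_ge (hb : ∀ i, covLin a t (b i) = l i • b i) (hl : ∀ i, 1 ≤ l i)
    (hd : 1 ≤ d) (hmin : ∀ i, minEig a t ≤ l i) {x : Vec d} {ρ : ℝ}
    (h : ∑ i with ¬ l i ≤ ρ, (inner ℝ (b i) x) ^ 2 / l i ≤ quad a t x / 2) :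
    minEig a t * (quad a t x / 2) ≤ ∑ i with l i ≤ ρ, (inner ℝ (b i) x) ^ 2 := by
  have hL := minEig_ge_one hd a t
  have h1 : quad a t x = _ := inner_covInv_eq_sum hb hl x
  rw [← Finset.sum_filter_add_sum_filter_not Finset.univ (fun i => l i ≤ ρ)] at h1
  have h2 : quad a t x / 2 ≤ ∑ i with l i ≤ ρ, (inner ℝ (b i) x) ^ 2 / l i := by linarith
  calc _ ≤ minEig a t * ∑ i with l i ≤ ρ, (inner ℝ (b i) x) ^ 2 / l i := by gcongr
    _ ≤ _ := by
      rw [Finset.mul_sum]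
      refine Finset.sum_le_sum fun i _ => ?_
      have h3 := hl i
      rw [← mul_div_assoc, div_le_iff₀ (by linarith), mul_comm]
      exact mul_le_mul_of_nonneg_left (hmin i) (sq_nonneg _)

theorem sum_large_le (x : Vec d) {ρ : ℝ} (hρ : 0 < ρ) :
    ∑ i with ¬ l i ≤ ρ, (inner ℝ (b i) x) ^ 2 / l i ≤ ‖x‖ ^ 2 / ρ := by
  rw [norm_sq_eq_sum b, Finset.sum_div]
  refine le_trans (Finset.sum_le_sum (g := fun i => (inner ℝ (b i) x) ^ 2 / ρ) fun i hi => ?_)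
    (Finset.sum_le_univ_sum_of_nonneg fun i => by positivity)
  have hi' := (Finset.mem_filter.1 hi).2
  push Not at hi'
  gcongr

/-- Split x = m + (x - m): for m the mean of past actions the first part has small form, and the
deviation is weighted by at most 1/ρ. -/
theorem sum_large_le_of_mean (hb : ∀ i, covLin a t (b i) = l i • b i) (hl : ∀ i, 1 ≤ l i)
    (x m : Vec d) {ρ : ℝ} (hρ : 0 < ρ) :
    ∑ i with ¬ l i ≤ ρ, (inner ℝ (b i) x) ^ 2 / l i ≤ 2 * quad a t m + 2 * (‖x - m‖ ^ 2 / ρ) := by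
  have h1 : ∑ i with ¬ l i ≤ ρ, (inner ℝ (b i) m) ^ 2 / l i ≤ quad a t m := by
    rw [quad, inner_covInv_eq_sum hb hl]
    exact Finset.sum_le_univ_sum_of_nonneg fun i => by have := hl i; positivity
  have h2 := sum_large_le (b := b) (l := l) (x - m) hρ
  refine le_trans ?_ (add_le_add (mul_le_mul_of_nonneg_left h1 zero_le_two)
    (mul_le_mul_of_nonneg_left h2 zero_le_two))
  rw [Finset.mul_sum, Finset.mul_sum, ← Finset.sum_add_distrib]
  refine Finset.sum_le_sum fun i _ => ?_
  have h3 := hl i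
  rw [inner_sub_right, ← mul_div_assoc, ← mul_div_assoc, ← add_div]
  gcongr
  nlinarith [sq_nonneg (inner ℝ (b i) x - 2 * inner ℝ (b i) m : ℝ)]

theorem norm_mean_sub_le (a : ℕ → Vec d) (θ : Vec d) {n : ℕ} (hn : 1 ≤ n) :
    ‖(n : ℝ)⁻¹ • ∑ s ∈ Finset.Icc 1 n, a s - θ‖ ≤
      (n : ℝ)⁻¹ * ∑ s ∈ Finset.Icc 1 n, ‖a s - θ‖ := by
  have hn0 : (n : ℝ) ≠ 0 := by positivity
  have h : (n : ℝ)⁻¹ • ∑ s ∈ Finset.Icc 1 n, a s - θ =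
      (n : ℝ)⁻¹ • ∑ s ∈ Finset.Icc 1 n, (a s - θ) := by
    rw [Finset.sum_sub_distrib, smul_sub]
    congr 1
    rw [Finset.sum_const, Nat.card_Icc, Nat.add_sub_cancel, ← Nat.cast_smul_eq_nsmul ℝ,
      inv_smul_smul₀ hn0]
  rw [h, norm_smul, norm_inv, Real.norm_natCast]
  gcongr
  exact norm_sum_le _ _

/-- If the actions so far average to nearly `θ`, the next action explores the directions whose
eigenvalue is of the order of the smallest one. -/
theorem explored_mass_ge (hd : 1 ≤ d) (hβ : 1 ≤ β) (ho : IsOptimistic β θ a T) {n : ℕ}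
    (hn : 1 ≤ n) (hnT : n < T)
    (havg : ∑ s ∈ Finset.Icc 1 n, ‖a s - θ‖ ≤ 20 * n * β / √(minEig a n))
    (hsmall : (minEig a n) ^ 2 ≤ 1 / 50 * β ^ 2 * n)
    (hb : ∀ i, covLin a n (b i) = l i • b i) (hl : ∀ i, 1 ≤ l i) (hmin : ∀ i, minEig a n ≤ l i) :
    min (1 / 5) (2 / 25 * β ^ 2 / minEig a n) ≤
      ∑ i with l i ≤ 30000 * minEig a n, (inner ℝ (b i) (a (n + 1))) ^ 2 := by
  obtain ⟨w, hw, hmax⟩ := ho.maximizes n hnT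
  have hα := ho.norm_le n hnT
  have hL := minEig_ge_one hd a n
  have hdist := ho.dist_le n hnT
  have hL0 : 0 < minEig a n := by linarith
  have hn0 : (0 : ℝ) < n := by exact_mod_cast hn
  rcases bonus_dichotomy hd (by linarith) hw hα hmax with h | h
  · refine (min_le_left _ _).trans (le_trans ?_ (small_mass_ge hb hl hd hmin (ρ := 30000 * minEig a n) ?_))
    · rw [div_le_iff₀ hL0] at h
      linarith
    · refine (sum_large_le _ (by positivity)).trans ?_
      have h1 : ‖a (n + 1)‖ ^ 2 / (30000 * minEig a n) ≤ 1 / (30000 * minEig a n) := by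
        gcongr
        exact pow_le_one₀ (norm_nonneg _) hα
      have h2 : 1 / (30000 * minEig a n) ≤ 2 / 5 / minEig a n / 2 := by
        rw [div_div, div_div, div_le_div_iff₀ (by positivity) (by positivity)]
        linarith
      linarith
  · refine (min_le_right _ _).trans (le_trans ?_ (small_mass_ge hb hl hd hmin (ρ := 30000 * minEig a n) ?_))
    · have : minEig a n * (4 / 25 * β ^ 2 / minEig a n ^ 2 / 2) = 2 / 25 * β ^ 2 / minEig a n := by
        field_simp
        norm_num
      rw [← this]
      gcongr
    -- The threshold 30000 is chosen for this case: 24²/30000 ≤ 1/50, and 1/n is also at most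
    -- (1/50)β²/λ² by `hsmall`, so the large part is at most 4/50, half of 4/25.
    · set m := (n : ℝ)⁻¹ • ∑ s ∈ Finset.Icc 1 n, a s
      refine (sum_large_le_of_mean hb hl _ m (by positivity)).trans ?_
      have h1 : quad a n m ≤ 1 / n := quad_mean_le a hn
      have h2 : ‖m - θ‖ ≤ 20 * β / √(minEig a n) := by
        refine (norm_mean_sub_le a θ hn).trans ?_
        rw [inv_mul_le_iff₀ hn0]
        refine havg.trans (le_of_eq ?_)
        ring
      have h3 : ‖a (n + 1) - m‖ ≤ 24 * β / √(minEig a n) := by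
        have := norm_sub_le (a (n + 1) - θ) (m - θ)
        rw [sub_sub_sub_cancel_right] at this
        calc _ ≤ 4 * β / √(minEig a n) + 20 * β / √(minEig a n) := by linarith
          _ = _ := by ring
      have h4 : ‖a (n + 1) - m‖ ^ 2 ≤ 576 * β ^ 2 / minEig a n := by
        calc _ ≤ (24 * β / √(minEig a n)) ^ 2 := by gcongr
          _ = _ := by rw [div_pow, Real.sq_sqrt hL0.le]; ring
      have h5 : ‖a (n + 1) - m‖ ^ 2 / (30000 * minEig a n) ≤ 1 / 50 * β ^ 2 / minEig a n ^ 2 := by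
        rw [div_le_div_iff₀ (by positivity) (by positivity)]
        rw [le_div_iff₀ hL0] at h4
        have : 0 ≤ β ^ 2 * minEig a n := by positivity
        nlinarith
      have h6 : (1 : ℝ) / n ≤ 1 / 50 * β ^ 2 / minEig a n ^ 2 := by
        rw [div_le_div_iff₀ (by positivity) (by positivity)]
        linarith
      have h7 : 4 / 25 * β ^ 2 / minEig a n ^ 2 = 8 * (1 / 50 * β ^ 2 / minEig a n ^ 2) := by ring
      linarith

end StepMass

/-! ### Lower bound on the smallest eigenvalue -/

/-- The order `min (t / d, β √(t / d))` of the smallest eigenvalue after `t` rounds. -/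
noncomputable def growth (d : ℕ) (β x : ℝ) : ℝ := min (x / d) (β * √(x / d))

section Growth

variable {d : ℕ} {β : ℝ}

theorem growth_nonneg (hβ : 0 ≤ β) {x : ℝ} (hx : 0 ≤ x) : 0 ≤ growth d β x :=
  le_min (by positivity) (by positivity)

theorem growth_mono (hβ : 0 ≤ β) {x y : ℝ} (h : x ≤ y) : growth d β x ≤ growth d β y := by
  unfold growth
  gcongr

theorem growth_mul_le (hβ : 0 ≤ β) {x μ : ℝ} (hμ : 1 ≤ μ) :
    growth d β (μ * x) ≤ μ * growth d β x := by
  have hμ0 : 0 ≤ μ := by linarith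
  unfold growth
  rw [mul_min_of_nonneg _ _ hμ0]
  refine min_le_min (by rw [mul_div_assoc]) ?_
  rw [mul_div_assoc, Real.sqrt_mul hμ0]
  have h1 : √μ ≤ μ := Real.sqrt_le_self_iff.2 (Or.inr hμ)
  have h2 : 0 ≤ β * √(x / d) := by positivity
  nlinarith

theorem growth_sq_le (hβ : 0 ≤ β) {x : ℝ} (hx : 0 ≤ x) :
    growth d β x ^ 2 ≤ β ^ 2 * (x / d) := by
  calc growth d β x ^ 2 ≤ (β * √(x / d)) ^ 2 :=
        pow_le_pow_left₀ (growth_nonneg hβ hx) (min_le_right _ _) 2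
    _ = _ := by rw [mul_pow, Real.sq_sqrt (by positivity)]

end Growth

theorem sum_one_div_sqrt_le (n : ℕ) : ∑ s ∈ Finset.Icc 1 n, 1 / √(s : ℝ) ≤ 2 * √n := by
  induction n with
  | zero => simp
  | succ n ih =>
    rw [Finset.sum_Icc_succ_top (by omega)]
    have h0 : 0 < √((n + 1 : ℕ) : ℝ) := Real.sqrt_pos.2 (by positivity)
    have h1 : 1 / √((n + 1 : ℕ) : ℝ) ≤ 2 * √((n + 1 : ℕ) : ℝ) - 2 * √n := by
      rw [div_le_iff₀ h0]
      have h2 : √((n + 1 : ℕ) : ℝ) ^ 2 = n + 1 := by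
        rw [Real.sq_sqrt (by positivity)]; push_cast; ring
      have h3 : √(n : ℝ) ^ 2 = n := Real.sq_sqrt (by positivity)
      nlinarith [sq_nonneg (√((n + 1 : ℕ) : ℝ) - √n)]
    linarith

section LowerBound

variable {d : ℕ} {β : ℝ} {a : ℕ → Vec d} {θ : Vec d} {T : ℕ}

/-- Action k + 1 is chosen from Λ_k; halving the constant pays for this index shift. At k = 0, where
the growth vanishes, λ_min ≥ 1 is used instead. -/
theorem half_growth_succ_le (hd : 1 ≤ d) (hβ : 0 ≤ β) {c : ℝ} (hc0 : 0 ≤ c) (hc : c ≤ 1) {k : ℕ}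
    (h : c * growth d β k ≤ minEig a k) : c / 2 * growth d β (k + 1) ≤ minEig a k := by
  rcases Nat.eq_zero_or_pos k with rfl | hk
  · have h1 : growth d β ((0 : ℕ) + 1) ≤ 1 := by
      refine (min_le_left _ _).trans ?_
      have : (1 : ℝ) ≤ d := by exact_mod_cast hd
      simp only [Nat.cast_zero, zero_add]
      rw [div_le_one (by linarith)]
      exact this
    have h2 := minEig_ge_one hd a 0
    have h3 := growth_nonneg (d := d) hβ (x := ((0 : ℕ) : ℝ) + 1) (by simp)
    have h4 : c / 2 * growth d β ((0 : ℕ) + 1) ≤ 1 * 1 := by gcongr; linarith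
    linarith
  · have hk1 : (1 : ℝ) ≤ k := by exact_mod_cast hk
    have h1 : growth d β (k + 1) ≤ 2 * growth d β k :=
      (growth_mono hβ (by linarith)).trans (growth_mul_le hβ (by norm_num))
    nlinarith

/-- The growth function is at most linear in ratios, so the hypotheses give s·λ_n ≤ 6n·λ_{s-1} for
the smallest eigenvalues. The distance at round s is then at most 4√6 ≤ 10 times β√(n/s)/√λ_n, and ∑
1/√s ≤ 2√n. -/
theorem sum_dist_le (hd : 1 ≤ d) (hβ : 0 ≤ β) (ho : IsOptimistic β θ a T) {c : ℝ} (hc0 : 0 < c)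
    (hc : c ≤ 1) {n : ℕ} (hnT : n ≤ T)
    (hlow : ∀ k < n, c * growth d β k ≤ minEig a k)
    (hup : minEig a n ≤ 3 * c * growth d β n) :
    ∑ s ∈ Finset.Icc 1 n, ‖a s - θ‖ ≤ 20 * n * β / √(minEig a n) := by
  have hL := minEig_ge_one hd a n
  have hL0 : 0 < √(minEig a n) := Real.sqrt_pos.2 (by linarith)
  have h6 : √6 ≤ 5 / 2 := Real.sqrt_le_iff.2 ⟨by norm_num, by norm_num⟩
  have hterm : ∀ s ∈ Finset.Icc 1 n, ‖a s - θ‖ ≤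
      10 * β * √n / √(minEig a n) * (1 / √(s : ℝ)) := by
    intro s hs
    obtain ⟨hs1, hsn⟩ := Finset.mem_Icc.1 hs
    obtain ⟨k, rfl⟩ : ∃ k, s = k + 1 := ⟨s - 1, by omega⟩
    have hs0 : (0 : ℝ) < (k + 1 : ℕ) := by positivity
    have hn0 : (0 : ℝ) < n := by exact_mod_cast (by omega : 0 < n)
    have hk1 := half_growth_succ_le hd hβ hc0.le hc (hlow k (by omega))
    have hk2 : growth d β n ≤ n / (k + 1 : ℕ) * growth d β (k + 1 : ℕ) := by
      have := growth_mul_le (d := d) hβ (x := (k + 1 : ℕ)) (μ := n / (k + 1 : ℕ))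
        (by rw [le_div_iff₀ hs0, one_mul]; exact_mod_cast hsn)
      rwa [div_mul_cancel₀ _ hs0.ne'] at this
    have hk3 : minEig a n * (k + 1 : ℕ) ≤ 6 * n * minEig a k := by
      rw [div_mul_eq_mul_div, le_div_iff₀ hs0] at hk2
      push_cast at hk2 ⊢
      have : minEig a n * (k + 1) ≤ 3 * c * growth d β n * (k + 1) := by gcongr
      nlinarith
    have hk4 : √(minEig a n) * √((k + 1 : ℕ) : ℝ) ≤ √6 * √n * √(minEig a k) := by
      rw [← Real.sqrt_mul (by linarith), ← Real.sqrt_mul (by norm_num),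
        ← Real.sqrt_mul (by positivity)]
      exact Real.sqrt_le_sqrt hk3
    have hk5 : 0 < √(minEig a k) := Real.sqrt_pos.2 (by linarith [minEig_ge_one hd a k])
    have hk6 : 0 < √((k + 1 : ℕ) : ℝ) := Real.sqrt_pos.2 hs0
    refine (ho.dist_le k (by omega)).trans ?_
    rw [div_mul_div_comm, mul_one, div_le_div_iff₀ hk5 (by positivity)]
    calc 4 * β * (√(minEig a n) * √((k + 1 : ℕ) : ℝ))
        ≤ 4 * β * (√6 * √n * √(minEig a k)) := by gcongr
      _ ≤ 4 * β * (5 / 2 * √n * √(minEig a k)) := by gcongr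
      _ = _ := by ring
  refine (Finset.sum_le_sum hterm).trans ?_
  rw [← Finset.mul_sum]
  calc _ ≤ 10 * β * √n / √(minEig a n) * (2 * √n) := by
        gcongr
        exact sum_one_div_sqrt_le n
    _ = 20 * (√n * √n) * β / √(minEig a n) := by ring
    _ = _ := by rw [Real.mul_self_sqrt (by positivity)]

/-- The smallest eigenvalue of `Λ_t` is at least of the order `min (t / d, β √(t / d))`. -/
theorem growth_le_minEig (hd : 1 ≤ d) (hβ : 1 ≤ β) (ho : IsOptimistic β θ a T) :
    ∀ t ≤ T, 1 / 3000000 * growth d β t ≤ minEig a t := by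
  intro t
  induction t using Nat.strong_induction_on with
  | _ t ih =>
  intro htT
  by_contra hcon
  push Not at hcon
  have hβ0 : 0 ≤ β := by linarith
  have hd0 : (0 : ℝ) < d := by exact_mod_cast hd
  set L := 1 / 3000000 * growth d β t with hLdef
  have hL1 : 1 < L := (minEig_ge_one hd a t).trans_lt hcon
  have hL2 : L ≤ 1 / 3000000 * (t / d) := by
    have : growth d β t ≤ t / d := min_le_left _ _
    rw [hLdef]
    linarith
  have hLt : 3000000 * L * d ≤ t := by
    have : L * 3000000 ≤ t / d := by linarith
    rw [le_div_iff₀ hd0] at this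
    linarith
  have ht2 : (2 : ℝ) ≤ t := by
    have h1 : (1 : ℝ) ≤ d := by exact_mod_cast hd
    nlinarith
  have ht2' : 2 ≤ t := by exact_mod_cast ht2
  have hLsq : L ^ 2 ≤ (1 / 3000000) ^ 2 * (β ^ 2 * (t / d)) := by
    rw [hLdef, mul_pow]
    gcongr
    exact growth_sq_le hβ0 (by positivity)
  set ρ := 30000 * L with hρ
  set m := min (1 / 5) (2 / 25 * β ^ 2 / L) with hm
  have hm0 : 0 < m := lt_min (by norm_num) (by positivity)
  -- Only the second half of the rounds is used: there t ≤ 3n, so failure of the bound at t makes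
  -- λ_min at n at most 3c·growth(n), as `sum_dist_le` needs.
  have hstep : ∀ n ∈ Finset.Ico (t / 2) t, m / (8 * ρ) ≤
      ‖covInv (fun s => (√(1 + ρ))⁻¹ • a s) n ((√(1 + ρ))⁻¹ • a (n + 1))‖ ^ 2 /
        (1 + quad (fun s => (√(1 + ρ))⁻¹ • a s) n ((√(1 + ρ))⁻¹ • a (n + 1))) := by
    intro n hn
    obtain ⟨hn1, hn2⟩ := Finset.mem_Ico.1 hn
    have hn0 : 1 ≤ n := by omega
    have ht3 : (t : ℝ) ≤ 3 * n := by exact_mod_cast (by omega : t ≤ 3 * n)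
    have hmono : minEig a n < L := (minEig_mono hd a hn2.le).trans_lt hcon
    have hmin1 := minEig_ge_one hd a n
    obtain ⟨b, l, j, hb, hl, hj, hmin, -⟩ := exists_eigenbasis_extreme hd a n
    refine le_trans ?_ (small_mass_le hb hl (by linarith) hd (ho.norm_le n (by omega)))
    gcongr
    have hup : minEig a n ≤ 3 * (1 / 3000000) * growth d β n := by
      have := (growth_mono (d := d) hβ0 ht3).trans
        (growth_mul_le hβ0 (by norm_num))
      linarith
    have hsmall : (minEig a n) ^ 2 ≤ 1 / 50 * β ^ 2 * n := by
      have h1 : minEig a n ^ 2 ≤ L ^ 2 := by gcongr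
      have h2 : (t : ℝ) / d ≤ 3 * n := by
        refine (div_le_self (by positivity) ?_).trans ht3
        exact_mod_cast hd
      have h3 : β ^ 2 * (t / d) ≤ β ^ 2 * (3 * n) := by gcongr
      have h4 : 0 ≤ β ^ 2 * n := by positivity
      linarith
    have havg := sum_dist_le hd hβ0 ho (by norm_num) (by norm_num) (by omega)
      (fun k hk => ih k (by omega) (by omega)) hup
    have hmass := explored_mass_ge hd hβ ho hn0 (by omega) havg hsmall hb hl hmin
    calc m ≤ min (1 / 5) (2 / 25 * β ^ 2 / minEig a n) := by
          refine min_le_min le_rfl ?_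
          gcongr
      _ ≤ _ := hmass
      _ ≤ _ := by
        refine Finset.sum_le_sum_of_subset_of_nonneg (fun i hi => ?_) fun i _ _ => sq_nonneg _
        simp only [Finset.mem_filter, Finset.mem_univ, true_and] at hi ⊢
        rw [hρ]
        linarith
  have hsum := sum_trace_decrease_le (fun s => (√(1 + ρ))⁻¹ • a s) t
  have hpart : (t : ℝ) / 2 * (m / (8 * ρ)) ≤ d := by
    refine le_trans ?_ hsum
    refine le_trans ?_ (Finset.sum_le_sum_of_subset_of_nonneg (s := Finset.Ico (t / 2) t)
      (fun n hn => Finset.mem_range.2 (Finset.mem_Ico.1 hn).2) fun n _ _ => ?_)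
    · refine le_trans ?_ (Finset.card_nsmul_le_sum _ _ _ hstep)
      rw [Nat.card_Ico, nsmul_eq_mul]
      gcongr
      have : t ≤ 2 * (t - t / 2) := by omega
      have h2 : (t : ℝ) ≤ 2 * ((t - t / 2 : ℕ) : ℝ) := by exact_mod_cast this
      linarith
    · have := quad_nonneg (fun s => (√(1 + ρ))⁻¹ • a s) n ((√(1 + ρ))⁻¹ • a (n + 1))
      positivity
  have hfin : t * m ≤ 480000 * L * d := by
    have h1 : (t : ℝ) / 2 * (m / (8 * ρ)) = t * m / (480000 * L) := by
      rw [hρ]; field_simp; norm_num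
    rw [h1, div_le_iff₀ (by positivity)] at hpart
    linarith
  -- The first branch gives t ≤ 2400000·L·d, against 3000000·L·d ≤ t; the second contradicts the
  -- bound on L² coming from β√(t/d).
  rcases min_choice (1 / 5) (2 / 25 * β ^ 2 / L) with h | h
  · rw [hm, h] at hfin
    nlinarith
  · rw [hm, h, ← mul_div_assoc, div_le_iff₀ (by linarith)] at hfin
    have h1 : 480000 * L * d * L ≤ 480000 * ((1 / 3000000) ^ 2 * (β ^ 2 * (t / d))) * d := by
      calc _ = 480000 * L ^ 2 * d := by ring
        _ ≤ _ := by gcongr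
    have h2 : 480000 * ((1 / 3000000 : ℝ) ^ 2 * (β ^ 2 * (t / d))) * d =
        480000 * (1 / 3000000) ^ 2 * (t * β ^ 2) := by
      field_simp
    have h3 : 0 < t * β ^ 2 := by positivity
    rw [h2] at h1
    linarith

end LowerBound

/-! ### Spectral shape and leading eigenvector -/

section Consequences

variable {d : ℕ} {β κ : ℝ} {a : ℕ → Vec d} {θ : Vec d} {T t : ℕ}

/-- Past κβ²d rounds √(t/d) ≥ √κ·β, so the linear branch t/d of the growth is at least √κ·β√(t/d).
-/
theorem minEig_ge_sqrt (hd : 1 ≤ d) (hβ : 1 ≤ β) (ho : IsOptimistic β θ a T)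
    (ht : κ * (β ^ 2 * d) ≤ t) (htT : t ≤ T) :
    1 / 3000000 * min 1 √κ * (β * √(t / d)) ≤ minEig a t := by
  have hd0 : (0 : ℝ) < d := by exact_mod_cast hd
  have h1 : √κ * β ≤ √(t / d) := by
    rw [← Real.sqrt_sq (by linarith : 0 ≤ β), ← Real.sqrt_mul' _ (sq_nonneg β)]
    apply Real.sqrt_le_sqrt
    rw [le_div_iff₀ hd0]
    linarith
  have h2 : √(t / d : ℝ) * √(t / d) = t / d := Real.mul_self_sqrt (by positivity)
  have h3 : 0 ≤ √(t / d : ℝ) := Real.sqrt_nonneg _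
  refine le_trans ?_ (growth_le_minEig hd hβ ho t htT)
  rw [mul_assoc]
  gcongr
  refine le_min ?_ ?_
  · calc _ ≤ √κ * (β * √(t / d)) := by gcongr; exact min_le_right _ _
      _ = √κ * β * √(t / d) := by ring
      _ ≤ √(t / d) * √(t / d) := by gcongr
      _ = _ := h2
  · have : 0 ≤ β * √(t / d) := by positivity
    exact mul_le_of_le_one_left this (min_le_left _ _)

/-- Valid from the first round: on the linear branch of the growth √(s/d) ≤ β, and the trivial bound
4 suffices; on the other branch it is 16β²/λ_min. -/
theorem dist_sq_le (hd : 1 ≤ d) (hβ : 1 ≤ β) (hθ : ‖θ‖ = 1) (ho : IsOptimistic β θ a T) {s : ℕ}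
    (hs : s ∈ Finset.Icc 1 T) : ‖a s - θ‖ ^ 2 ≤ 96000000 * β * √d * (1 / √(s : ℝ)) := by
  obtain ⟨hs1, hsn⟩ := Finset.mem_Icc.1 hs
  obtain ⟨k, rfl⟩ : ∃ k, s = k + 1 := ⟨s - 1, by omega⟩
  have hβ0 : 0 ≤ β := by linarith
  have hd0 : (0 : ℝ) < d := by exact_mod_cast hd
  have hs0 : (0 : ℝ) < (k + 1 : ℕ) := by positivity
  have hlow := half_growth_succ_le hd hβ0 (by norm_num) (by norm_num)
    (growth_le_minEig hd hβ ho k (by omega))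
  have hk := minEig_ge_one hd a k
  set x := √((k + 1 : ℕ) : ℝ) with hx
  have hx0 : 0 < x := Real.sqrt_pos.2 hs0
  have hy0 : 0 < √(d : ℝ) := Real.sqrt_pos.2 hd0
  have h2 : ‖a (k + 1) - θ‖ ≤ 2 := by
    have := norm_sub_le (a (k + 1)) θ
    have := ho.norm_le k (by omega)
    linarith
  have h4 : ‖a (k + 1) - θ‖ ^ 2 ≤ 16 * β ^ 2 / minEig a k := by
    calc _ ≤ (4 * β / √(minEig a k)) ^ 2 := by
          gcongr
          exact ho.dist_le k (by omega)
      _ = _ := by rw [div_pow, Real.sq_sqrt (by linarith)]; ring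
  have hsd : √(((k + 1 : ℕ) : ℝ) / d) = x / √d := Real.sqrt_div' _ hd0.le
  rw [mul_one_div, le_div_iff₀ hx0]
  have hcast : ((k : ℝ) + 1) = ((k + 1 : ℕ) : ℝ) := by push_cast; ring
  rw [hcast] at hlow
  rcases min_choice (((k + 1 : ℕ) : ℝ) / d) (β * √(((k + 1 : ℕ) : ℝ) / d)) with h | h
  · have h5 := min_eq_left_iff.1 h
    have h6 : (((k + 1 : ℕ) : ℝ) / d) = x / √d * (x / √d) := by
      rw [← hsd, Real.mul_self_sqrt (by positivity)]
    rw [hsd, h6] at h5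
    have h7 := le_of_mul_le_mul_right h5 (by positivity)
    rw [div_le_iff₀ hy0] at h7
    have h8 : ‖a (k + 1) - θ‖ ^ 2 ≤ 2 ^ 2 := by gcongr
    have h9 : 0 ≤ β * √d := by positivity
    nlinarith
  · rw [growth, h, hsd] at hlow
    rw [le_div_iff₀ (by linarith)] at h4
    have h5 : ‖a (k + 1) - θ‖ ^ 2 * (1 / 3000000 / 2 * (β * (x / √d))) ≤ 16 * β ^ 2 :=
      le_trans (by gcongr) h4
    have h6 : β * (‖a (k + 1) - θ‖ ^ 2 * x) ≤ β * (96000000 * β * √d) := by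
      have h7 : ‖a (k + 1) - θ‖ ^ 2 * (1 / 3000000 / 2 * (β * (x / √d))) =
          β * (‖a (k + 1) - θ‖ ^ 2 * x) / (6000000 * √d) := by
        field_simp
        ring
      rw [h7, div_le_iff₀ (by positivity)] at h5
      linarith
    exact le_of_mul_le_mul_left h6 (by linarith)

theorem sum_dist_sq_le (hd : 1 ≤ d) (hβ : 1 ≤ β) (hθ : ‖θ‖ = 1) (ho : IsOptimistic β θ a T)
    (htT : t ≤ T) :
    ∑ s ∈ Finset.Icc 1 t, ‖a s - θ‖ ^ 2 ≤ 192000000 * β * √d * √t := by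
  refine (Finset.sum_le_sum fun s hs => dist_sq_le hd hβ hθ ho
    (Finset.Icc_subset_Icc_right htT hs)).trans ?_
  rw [← Finset.mul_sum]
  calc _ ≤ 96000000 * β * √d * (2 * √t) := by
        gcongr
        exact sum_one_div_sqrt_le t
    _ = _ := by ring

/-- Trace minus top eigenvalue, the latter bounded below by the Rayleigh quotient at θ; then ‖a‖² -
⟨a,θ⟩² ≤ ‖a - θ‖² because (1 - ⟨a,θ⟩)² ≥ 0. -/
theorem sum_nonleading_le (hd : 1 ≤ d) (hθ : ‖θ‖ = 1) (a : ℕ → Vec d) (t : ℕ) :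
    ∑ i ∈ Finset.Icc 2 d, eig a t i ≤ (d - 1) + ∑ s ∈ Finset.Icc 1 t, ‖a s - θ‖ ^ 2 := by
  obtain ⟨b, l, hb, hl, -⟩ := exists_eigenbasis a t
  have h1 := sum_eig hl
  rw [sum_eigenvalues hb, ← Finset.add_sum_Ioc_eq_sum_Icc hd] at h1
  have h2 := le_maxEig_mul hd a t θ
  rw [inner_covLin, real_inner_self_eq_norm_sq, hθ] at h2
  have h3 : ∑ s ∈ Finset.Icc 1 t, ‖a s‖ ^ 2 ≤
      ∑ s ∈ Finset.Icc 1 t, (inner ℝ (a s) θ * inner ℝ (a s) θ + ‖a s - θ‖ ^ 2) := by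
    refine Finset.sum_le_sum fun s _ => ?_
    rw [norm_sub_sq_real, hθ]
    nlinarith [sq_nonneg (1 - inner ℝ (a s) θ : ℝ)]
  rw [Finset.sum_add_distrib] at h3
  have h4 : Finset.Ioc 1 d = Finset.Icc 2 d := by ext; simp; omega
  rw [h4] at h1
  linarith

theorem meanEig_le (hd : 2 ≤ d) (hκ : 0 < κ) (hβ : 1 ≤ β) (hθ : ‖θ‖ = 1)
    (ho : IsOptimistic β θ a T) (ht : κ * (β ^ 2 * d) ≤ t) (htT : t ≤ T) :
    meanEig a t ≤ (1 / √κ + 384000000) * (β * √(t / d)) := by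
  have hd2 : (2 : ℝ) ≤ d := by exact_mod_cast hd
  have hd0 : (0 : ℝ) < d := by linarith
  have hκ0 : 0 < √κ := Real.sqrt_pos.2 hκ
  have h1 : √κ * β ≤ √(t / d) := by
    rw [← Real.sqrt_sq (by linarith : 0 ≤ β), ← Real.sqrt_mul' _ (sq_nonneg β)]
    apply Real.sqrt_le_sqrt
    rw [le_div_iff₀ hd0]
    linarith
  -- Absorbs the contribution of the identity to the mean; this is where 1/√κ enters the constant.
  have h2 : 1 ≤ 1 / √κ * (β * √(t / d)) := by
    rw [one_div, inv_mul_eq_div, one_le_div hκ0]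
    calc √κ ≤ √κ * β := le_mul_of_one_le_right hκ0.le hβ
      _ ≤ √(t / d) := h1
      _ ≤ _ := le_mul_of_one_le_left (Real.sqrt_nonneg _) hβ
  have h3 := (sum_nonleading_le (by omega) hθ a t).trans
    (add_le_add_right (sum_dist_sq_le (by omega) hβ hθ ho htT) _)
  have h4 : √d * √t = √(t / d) * d := by
    rw [Real.sqrt_div' _ hd0.le]
    have : √(d : ℝ) * √d = d := Real.mul_self_sqrt hd0.le
    have h0 : √(d : ℝ) ≠ 0 := by positivity
    field_simp
    rw [sq, this]
    ring
  rw [meanEig, div_le_iff₀ (by linarith)]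
  refine h3.trans ?_
  rw [mul_assoc _ √(d : ℝ), h4]
  have h5 : 0 ≤ β * √(t / d) := by positivity
  have h6 : β * √(t / d) * d ≤ β * √(t / d) * (2 * (d - 1)) := by
    gcongr
    linarith
  nlinarith

theorem minEig_le_meanEig (hd : 2 ≤ d) (a : ℕ → Vec d) (t : ℕ) : minEig a t ≤ meanEig a t := by
  have hd2 : (2 : ℝ) ≤ d := by exact_mod_cast hd
  obtain ⟨b, l, hb, hl, hanti⟩ := exists_eigenbasis a t
  rw [meanEig, le_div_iff₀ (by linarith)]
  have h : ∀ i ∈ Finset.Icc 2 d, minEig a t ≤ eig a t i := by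
    intro i hi
    obtain ⟨hi1, hi2⟩ := Finset.mem_Icc.1 hi
    have h1 := hanti (a := ⟨i - 1, by omega⟩) (b := ⟨d - 1, by omega⟩) (by
      rw [Fin.le_def]; simp only; omega)
    rw [hl, hl] at h1
    simp only at h1
    rwa [Nat.sub_add_cancel (by omega), Nat.sub_add_cancel (by omega)] at h1
  have h2 := Finset.card_nsmul_le_sum _ _ _ h
  rw [Nat.card_Icc, nsmul_eq_mul] at h2
  have h3 : ((d + 1 - 2 : ℕ) : ℝ) = d - 1 := by
    rw [Nat.cast_sub (by omega)]
    push_cast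
    ring
  rw [h3] at h2
  linarith

/-- Let S be the sum of distances. If t ≤ 4S the claim is trivial; otherwise λ₁ - 1 ≥ t - 2S ≥ t/2.
For the component p of v orthogonal to θ, pairing the eigenvector equation with p gives (λ₁ - 1)‖p‖²
≤ S‖p‖, since ⟨a_s, p⟩ = ⟨a_s - θ, p⟩. The sign choice gives ‖v - θ‖ ≤ 2‖p‖. -/
theorem leading_eigenvector_dist_le (hd : 1 ≤ d) (hθ : ‖θ‖ = 1) (ha : ∀ s ∈ Finset.Icc 1 t, ‖a s‖ ≤ 1)
    {v : Vec d} (hv : IsLeadingEigenvector θ a t v) :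
    t * ‖v - θ‖ ≤ 8 * ∑ s ∈ Finset.Icc 1 t, ‖a s - θ‖ := by
  obtain ⟨hv1, hveig, hpos⟩ := hv
  have hveig' : covLin a t v = eig a t 1 • v := by
    ext i
    have := congrFun hveig i
    simpa [covLin] using this
  set S := ∑ s ∈ Finset.Icc 1 t, ‖a s - θ‖ with hS
  have ht0 : (0 : ℝ) ≤ t := Nat.cast_nonneg t
  have hvθ : ‖v - θ‖ ≤ 2 := by
    have := norm_sub_le v θ
    linarith
  rcases le_total (t : ℝ) (4 * S) with h | h
  · nlinarith [norm_nonneg (v - θ)]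
  have hlead : (t : ℝ) - 2 * S ≤ eig a t 1 - 1 := by
    have h2 := le_maxEig_mul hd a t θ
    rw [inner_covLin, real_inner_self_eq_norm_sq, hθ] at h2
    have h3 : ∑ s ∈ Finset.Icc 1 t, (1 - 2 * ‖a s - θ‖) ≤
        ∑ s ∈ Finset.Icc 1 t, inner ℝ (a s) θ * inner ℝ (a s) θ := by
      refine Finset.sum_le_sum fun s _ => ?_
      have h4 : (inner ℝ (a s) θ : ℝ) = 1 + inner ℝ (a s - θ) θ := by
        rw [inner_sub_left, real_inner_self_eq_norm_sq, hθ]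
        ring
      have h5 := abs_le.1 (abs_real_inner_le_norm (a s - θ) θ)
      rw [hθ, mul_one] at h5
      rw [h4]
      nlinarith [sq_nonneg (inner ℝ (a s - θ) θ : ℝ)]
    rw [Finset.sum_sub_distrib, ← Finset.mul_sum] at h3
    simp at h3
    linarith
  set x : ℝ := inner ℝ v θ with hx
  have hx1 : x ≤ 1 := by
    have := real_inner_le_norm v θ
    rwa [hv1, hθ, one_mul] at this
  set p := v - x • θ with hp
  have hθp : inner ℝ θ p = (0 : ℝ) := by
    rw [hp, inner_sub_right, inner_smul_right, real_inner_self_eq_norm_sq, hθ, real_inner_comm]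
    simp [hx]
  have hpv : inner ℝ p v = 1 - x ^ 2 := by
    rw [hp, inner_sub_left, inner_smul_left, real_inner_self_eq_norm_sq, hv1, real_inner_comm, ← hx]
    simp
    ring
  have hpp : ‖p‖ ^ 2 = 1 - x ^ 2 := by
    rw [← hpv, ← real_inner_self_eq_norm_sq]
    have : v = p + x • θ := by rw [hp]; simp
    conv_rhs => rw [this, inner_add_right, inner_smul_right, real_inner_comm θ, hθp]
    simp
  have hmain : (eig a t 1 - 1) * ‖p‖ ^ 2 ≤ S * ‖p‖ := by
    have h1 := inner_covLin a t p v
    rw [hveig', inner_smul_right, hpv, ← hpp] at h1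
    have h2 : ∑ s ∈ Finset.Icc 1 t, inner ℝ (a s) p * inner ℝ (a s) v ≤ S * ‖p‖ := by
      rw [hS, Finset.sum_mul]
      refine Finset.sum_le_sum fun s hs => ?_
      have h3 : (inner ℝ (a s) p : ℝ) = inner ℝ (a s - θ) p := by
        rw [inner_sub_left, hθp, sub_zero]
      have h4 : |(inner ℝ (a s) p : ℝ)| ≤ ‖a s - θ‖ * ‖p‖ := by
        rw [h3]
        exact abs_real_inner_le_norm _ _
      have h5 : |(inner ℝ (a s) v : ℝ)| ≤ 1 := by
        refine (abs_real_inner_le_norm _ _).trans ?_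
        rw [hv1, mul_one]
        exact ha s hs
      refine (le_abs_self _).trans ?_
      rw [abs_mul]
      exact (mul_le_of_le_one_right (abs_nonneg _) h5).trans h4
    linarith
  have hS0 : 0 ≤ S := Finset.sum_nonneg fun s _ => norm_nonneg _
  have hp1 : t * ‖p‖ ≤ 2 * S := by
    rcases (norm_nonneg p).eq_or_lt with h0 | h0
    · rw [← h0]; linarith
    · have h1 : (eig a t 1 - 1) * ‖p‖ * ‖p‖ ≤ S * ‖p‖ := by linarith
      have h2 := le_of_mul_le_mul_right h1 h0
      have h3 : (t - 2 * S) * ‖p‖ ≤ (eig a t 1 - 1) * ‖p‖ := by gcongr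
      nlinarith
  have hvp : ‖v - θ‖ ≤ 2 * ‖p‖ := by
    refine abs_le_of_sq_le_sq' ?_ (by positivity) |>.2
    rw [norm_sub_sq_real, hv1, hθ, mul_pow, hpp, ← hx]
    nlinarith
  nlinarith

/-- Spectral shape of `Λ_t` and alignment of its leading eigenvector, for optimistic runs. -/
theorem spectrum_of_isOptimistic (hκ : 0 < κ) :
    ∃ c > (0 : ℝ), ∃ C > (0 : ℝ), ∀ (d : ℕ) (_ : 2 ≤ d) (T : ℕ) (β : ℝ) (_ : 1 ≤ β)
      (θ : Vec d) (_ : ‖θ‖ = 1) (a : ℕ → Vec d) (_ : IsOptimistic β θ a T) (t : ℕ),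
      κ * (β ^ 2 * d) ≤ t → t ≤ T →
        Comparable c C (eig a t d) (meanEig a t) ∧
        Comparable c C (meanEig a t) (β * √((t : ℝ) / d)) ∧
        ∀ v : Vec d, IsLeadingEigenvector θ a t v → ‖v - θ‖ ≤ C * (β / √(eig a t d)) := by
  have hκ0 : 0 < √κ := Real.sqrt_pos.2 hκ
  set c₁ : ℝ := 1 / 3000000 * min 1 √κ with hc₁
  have hc₁0 : 0 < c₁ := by positivity
  set C₂ : ℝ := 1 / √κ + 384000000 with hC₂
  have hC₂0 : 1 ≤ C₂ := by
    have : 0 < 1 / √κ := by positivity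
    linarith
  refine ⟨c₁ / C₂, by positivity, C₂ + 8 * √(192000000 * C₂), by positivity, ?_⟩
  intro d hd T β hβ θ hθ a ho t ht htT
  have hd0 : (0 : ℝ) < d := by exact_mod_cast (by omega : 0 < d)
  have hβ0 : 0 < β := by linarith
  have ht0 : (0 : ℝ) < t := lt_of_lt_of_le (by positivity) ht
  have hlow := minEig_ge_sqrt (by omega) hβ ho ht htT
  have hup := meanEig_le hd hκ hβ hθ ho ht htT
  have hle := minEig_le_meanEig hd a t
  have h1 := minEig_ge_one (by omega : 1 ≤ d) a t
  rw [← hc₁] at hlow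
  rw [← hC₂] at hup
  change Comparable _ _ (minEig a t) _ ∧ _ ∧ ∀ v, _ → _ ≤ _ * (β / √(minEig a t))
  set g := β * √((t : ℝ) / d) with hg
  have hg0 : 0 < g := by positivity
  have hC8 : 0 ≤ 8 * √(192000000 * C₂) := by positivity
  have hm0 : 0 < meanEig a t := by linarith
  refine ⟨⟨?_, ?_⟩, ⟨?_, ?_⟩, ?_⟩
  · rw [div_mul_eq_mul_div, div_le_iff₀ (by linarith)]
    calc c₁ * meanEig a t ≤ c₁ * (C₂ * g) := by gcongr
      _ = c₁ * g * C₂ := by ring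
      _ ≤ _ := by gcongr
  · nlinarith
  · have : c₁ / C₂ ≤ c₁ := div_le_self hc₁0.le hC₂0
    calc _ ≤ c₁ * g := by gcongr
      _ ≤ _ := by linarith
  · nlinarith
  · intro v hv
    have hvd := leading_eigenvector_dist_le (by omega) hθ (fun s hs => by
      obtain ⟨hs1, hs2⟩ := Finset.mem_Icc.1 hs
      obtain ⟨k, rfl⟩ : ∃ k, s = k + 1 := ⟨s - 1, by omega⟩
      exact ho.norm_le k (by omega)) hv
    have hcs := sq_sum_le_card_mul_sum_sq (s := Finset.Icc 1 t) (f := fun s => ‖a s - θ‖)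
    rw [Nat.card_Icc, Nat.add_sub_cancel] at hcs
    have hD := sum_dist_sq_le (by omega) hβ hθ ho htT
    set S := ∑ s ∈ Finset.Icc 1 t, ‖a s - θ‖
    have hS0 : 0 ≤ S := Finset.sum_nonneg fun s _ => norm_nonneg _
    have hL0 : 0 < √(minEig a t) := Real.sqrt_pos.2 (by linarith)
    -- Cauchy–Schwarz gives S² ≲ tβ√(dt), and λ_min ≲ β√(t/d): in the product the powers of d
    -- cancel.
    have hS : (S * √(minEig a t)) ^ 2 ≤ (t * (√(192000000 * C₂) * β)) ^ 2 := by
      rw [mul_pow, mul_pow, mul_pow, Real.sq_sqrt (by linarith), Real.sq_sqrt (by positivity)]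
      have e1 : √(d : ℝ) * √t * √(t / d) = t := by
        rw [Real.sqrt_div' _ hd0.le]
        have : √(t : ℝ) * √t = t := Real.mul_self_sqrt ht0.le
        have h0 : √(d : ℝ) ≠ 0 := by positivity
        field_simp
        rw [sq, this]
      calc S ^ 2 * minEig a t ≤ t * (192000000 * β * √d * √t) * (C₂ * g) := by
            gcongr
            · exact hcs.trans (by gcongr)
            · linarith
        _ = t * (192000000 * C₂ * β ^ 2) * (√(d : ℝ) * √t * √(t / d)) := by rw [hg]; ring
        _ = _ := by rw [e1]; ring
    have hS' := abs_le_of_sq_le_sq' hS (by positivity) |>.2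
    have hfin : t * (‖v - θ‖ * √(minEig a t)) ≤ t * (8 * √(192000000 * C₂) * β) := by
      calc _ = t * ‖v - θ‖ * √(minEig a t) := by ring
        _ ≤ 8 * S * √(minEig a t) := by gcongr
        _ ≤ _ := by linarith
    have hfin2 := le_of_mul_le_mul_left hfin ht0
    rw [← mul_div_assoc, le_div_iff₀ hL0]
    refine hfin2.trans ?_
    gcongr
    linarith

end Consequences

/-! ### From the confidence bound to optimism -/

theorem norm_sphereProj_le {d : ℕ} {e x : Vec d} (he : ‖e‖ ≤ 1) : ‖sphereProj e x‖ ≤ 1 := by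
  unfold sphereProj
  split_ifs with h
  · exact he
  · rw [norm_smul, norm_inv, norm_norm, inv_mul_cancel₀ (norm_ne_zero_iff.2 h)]

theorem norm_sphereProj_sub_le {d : ℕ} {e x θ : Vec d} (hx : x ≠ 0) (hθ : ‖θ‖ = 1) :
    ‖sphereProj e x - θ‖ ≤ 2 * ‖x - θ‖ := by
  rw [sphereProj, if_neg hx]
  have hx0 : 0 < ‖x‖ := norm_pos_iff.2 hx
  have h1 : ‖‖x‖⁻¹ • x - x‖ ≤ ‖x - θ‖ := by
    have : ‖x‖⁻¹ • x - x = ((1 - ‖x‖) * ‖x‖⁻¹) • x := by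
      rw [sub_mul, mul_inv_cancel₀ hx0.ne', sub_smul, one_mul, one_smul]
    rw [this, norm_smul, norm_mul, norm_inv, norm_norm, mul_assoc, inv_mul_cancel₀ hx0.ne', mul_one,
      ← hθ, norm_sub_rev x θ]
    exact abs_norm_sub_norm_le θ x
  have h2 := norm_sub_le_norm_sub_add_norm_sub (‖x‖⁻¹ • x) x θ
  linarith

/-- Against the competitor w, leaving w costs at least ‖α - w‖²/2 in the linear term and gains at
most β‖α - w‖/√λ_min in bonus. -/
theorem norm_maximizer_sub_le {d : ℕ} (hd : 1 ≤ d) {β : ℝ} (hβ : 0 < β) {a : ℕ → Vec d} {t : ℕ}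
    {w α : Vec d} (hw : ‖w‖ = 1) (hα : ‖α‖ ≤ 1)
    (hmax : ∀ b : Vec d, ‖b‖ ≤ 1 → objective β a t w b ≤ objective β a t w α) :
    ‖α - w‖ ≤ 2 * β / √(minEig a t) := by
  have h1 := hmax w hw.le
  have h2 : √(quad a t α) ≤ √(quad a t (α - w)) + √(quad a t w) := by
    have := sqrt_quad_add_le a t (α - w) w
    rwa [sub_add_cancel] at this
  have h3 : √(quad a t (α - w)) ≤ ‖α - w‖ / √(minEig a t) := by
    rw [← Real.sqrt_sq (norm_nonneg (α - w)), ← Real.sqrt_div (sq_nonneg _)]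
    exact Real.sqrt_le_sqrt (covInv_le hd a t _)
  have h4 : ‖α - w‖ ^ 2 ≤ 2 - 2 * inner ℝ α w := by
    rw [norm_sub_sq_real, hw]
    nlinarith [norm_nonneg α]
  rw [objective, objective, real_inner_self_eq_norm_sq, hw] at h1
  have h5 : ‖α - w‖ ^ 2 ≤ 2 * (β * (‖α - w‖ / √(minEig a t))) := by
    have : β * √(quad a t α) ≤ β * (‖α - w‖ / √(minEig a t) + √(quad a t w)) := by
      gcongr
      linarith
    linarith
  rcases (norm_nonneg (α - w)).eq_or_lt with h0 | h0
  · rw [← h0]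
    positivity
  · have h6 : ‖α - w‖ * ‖α - w‖ ≤ (2 * β / √(minEig a t)) * ‖α - w‖ := by
      calc _ = ‖α - w‖ ^ 2 := (sq _).symm
        _ ≤ _ := h5
        _ = _ := by ring
    exact le_of_mul_le_mul_right h6 h0

/-- On the confidence event, LinUCB is optimistic. -/
theorem isOptimistic_of_confidence {d : ℕ} (hd : 1 ≤ d) {T : ℕ} {β : ℝ} (hβ : 1 ≤ β)
    {θ e : Vec d} (hθ : ‖θ‖ = 1) (he : ‖e‖ ≤ 1) {a : ℕ → Vec d} {r : ℕ → ℝ}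
    (ha : ∀ t ∈ Finset.Icc 1 T, ‖a t‖ ≤ 1)
    (hmax : ∀ t ∈ Finset.Icc 1 T, ∀ b : Vec d, ‖b‖ ≤ 1 → ucb β e a r t b ≤ ucb β e a r t (a t))
    (hconf : ∀ t ≤ T, ‖ridge a r t - θ‖ ≤ β / √(minEig a t)) : IsOptimistic β θ a T := by
  have hobj : ∀ n < T, ∀ b : Vec d, ‖b‖ ≤ 1 →
      objective β a n (sphereProj e (ridge a r n)) b ≤
        objective β a n (sphereProj e (ridge a r n)) (a (n + 1)) := by
    intro n hn b hb
    have h := hmax (n + 1) (Finset.mem_Icc.2 ⟨by omega, by omega⟩) b hb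
    rwa [ucb_eq, ucb_eq, Nat.add_sub_cancel] at h
  have han : ∀ n < T, ‖a (n + 1)‖ ≤ 1 := fun n hn =>
    ha (n + 1) (Finset.mem_Icc.2 ⟨by omega, by omega⟩)
  refine ⟨han, fun n hn => ⟨_, norm_sphereProj_le he, hobj n hn⟩, fun n hn => ?_⟩
  have hc := hconf n hn.le
  -- At a zero estimate the projection carries no information, but then 1 = ‖θ‖ ≤ β/√λ_min and the
  -- trivial distance bound 2 suffices.
  by_cases hr : ridge a r n = 0
  · rw [hr, zero_sub, norm_neg, hθ] at hc
    have := norm_sub_le (a (n + 1)) θ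
    have := han n hn
    calc _ ≤ 4 * 1 := by linarith
      _ ≤ 4 * (β / √(minEig a n)) := by gcongr
      _ = _ := by ring
  · have h1 := norm_sphereProj_sub_le (e := e) hr hθ
    have hw : ‖sphereProj e (ridge a r n)‖ = 1 := by
      rw [sphereProj, if_neg hr, norm_smul, norm_inv, norm_norm,
        inv_mul_cancel₀ (norm_ne_zero_iff.2 hr)]
    have h2 := norm_maximizer_sub_le hd (by linarith) hw (han n hn) (hobj n hn)
    have h3 := norm_sub_le_norm_sub_add_norm_sub (a (n + 1)) (sphereProj e (ridge a r n)) θ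
    calc _ ≤ 2 * β / √(minEig a n) + 2 * (β / √(minEig a n)) := by linarith
      _ = _ := by ring

/-! ### Ridge error, noise sum and determinant -/

/-- The noise-weighted sum of the actions. -/
noncomputable def noiseSum {d : ℕ} (a : ℕ → Vec d) (ε : ℕ → ℝ) (t : ℕ) : Vec d :=
  ∑ s ∈ Finset.Icc 1 t, ε s • a s

/-- The error is Λ⁻¹(S - θ) with S the noise sum; the term -θ is the regularization bias and
accounts for the summand 1. -/
theorem norm_ridge_sub_le {d : ℕ} (hd : 1 ≤ d) {θ : Vec d} (hθ : ‖θ‖ = 1) (a : ℕ → Vec d)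
    (r : ℕ → ℝ) (t : ℕ) {R : ℝ}
    (hR : √(quad a t (noiseSum a (fun s => r s - inner ℝ (a s) θ) t)) ≤ R) :
    ‖ridge a r t - θ‖ ≤ (R + 1) / √(minEig a t) := by
  set S := noiseSum a (fun s => r s - inner ℝ (a s) θ) t with hS
  have hL := minEig_ge_one hd a t
  have h1 : ridge a r t - θ = covInv a t (S - θ) := by
    rw [ridge_eq]
    conv_lhs => rw [← covInv_covLin a t θ]
    rw [← map_sub, covLin_apply, hS, noiseSum]
    congr 1
    simp only [sub_smul, Finset.sum_sub_distrib]
    abel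
  have h2 : minEig a t * ‖ridge a r t - θ‖ ^ 2 ≤ quad a t (S - θ) := by
    have := minEig_mul_le hd a t (covInv a t (S - θ))
    rw [covLin_covInv, real_inner_comm, ← h1] at this
    rwa [quad, ← h1]
  have h3 : √(quad a t (S - θ)) ≤ R + 1 := by
    have h4 := sqrt_quad_add_le a t S (-θ)
    have h5 : quad a t (-θ) ≤ 1 := by
      refine (covInv_le hd a t (-θ)).trans ?_
      rw [norm_neg, hθ, one_pow]
      exact div_le_one_of_le₀ hL (by linarith)
    have h6 : √(quad a t (-θ)) ≤ 1 := Real.sqrt_le_one.2 h5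
    rw [← sub_eq_add_neg] at h4
    linarith
  rw [le_div_iff₀ (Real.sqrt_pos.2 (by linarith)), mul_comm, ← Real.sqrt_sq (norm_nonneg _),
    ← Real.sqrt_mul (by linarith)]
  exact (Real.sqrt_le_sqrt h2).trans h3

/-- One-step update of the self-normalized quadratic form. -/
theorem quad_noiseSum_succ {d : ℕ} (a : ℕ → Vec d) (ε : ℕ → ℝ) (t : ℕ) :
    quad a (t + 1) (noiseSum a ε (t + 1)) = quad a t (noiseSum a ε t) +
      (2 * ε (t + 1) * inner ℝ (a (t + 1)) (covInv a t (noiseSum a ε t)) +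
        ε (t + 1) ^ 2 * quad a t (a (t + 1)) -
        (inner ℝ (a (t + 1)) (covInv a t (noiseSum a ε t))) ^ 2) /
        (1 + quad a t (a (t + 1))) := by
  have h : noiseSum a ε (t + 1) = noiseSum a ε t + ε (t + 1) • a (t + 1) := by
    rw [noiseSum, Finset.sum_Icc_succ_top (by omega)]
    rfl
  have hw := quad_nonneg a t (a (t + 1))
  rw [quad_succ, h, quad_add_smul, map_add, map_smul, inner_add_right, inner_smul_right]
  change _ - (_ + _ * quad a t (a (t + 1))) ^ 2 / _ = _
  field_simp
  ring

theorem det_cov_succ {d : ℕ} (a : ℕ → Vec d) (t : ℕ) :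
    (cov a (t + 1)).det = (cov a t).det * (1 + quad a t (a (t + 1))) := by
  have h : cov a (t + 1) = cov a t +
      Matrix.replicateCol Unit (a (t + 1)).ofLp * Matrix.replicateRow Unit (a (t + 1)).ofLp := by
    rw [cov, Finset.sum_Icc_succ_top (by omega), ← add_assoc, ← Matrix.vecMulVec_eq]
    rfl
  rw [h, Matrix.det_add_replicateCol_mul_replicateRow (cov_isUnit_det a t)]
  congr 1
  rw [Matrix.mul_assoc, ← Matrix.replicateCol_mulVec, Matrix.det_unique, Matrix.add_apply,
    Matrix.one_apply_eq, Matrix.replicateRow_mul_replicateCol_apply, quad,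
    EuclideanSpace.inner_eq_star_dotProduct]
  simp [covInv, dotProduct_comm]

theorem log_det_cov_le {d : ℕ} (hd : 1 ≤ d) (a : ℕ → Vec d) {t T : ℕ} (htT : t ≤ T)
    (ha : ∀ s ∈ Finset.Icc 1 T, ‖a s‖ ≤ 1) :
    Real.log (cov a t).det ≤ d * Real.log (1 + T / d) := by
  have hd0 : (0 : ℝ) < d := by exact_mod_cast hd
  have hH := cov_isHermitian a t
  have hpos : ∀ i, 0 < hH.eigenvalues i := fun i => (cov_posDef a t).eigenvalues_pos i
  have hdet : (cov a t).det = ∏ i, hH.eigenvalues i := by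
    simpa using hH.det_eq_prod_eigenvalues
  have htr : ∑ i, hH.eigenvalues i ≤ d + T := by
    have hb : ∀ i, covLin a t (hH.eigenvectorBasis i) = hH.eigenvalues i • hH.eigenvectorBasis i := by
      intro i
      ext j
      simpa [covLin] using congrFun (hH.mulVec_eigenvectorBasis i) j
    rw [sum_eigenvalues hb]
    have h1 : ∑ s ∈ Finset.Icc 1 t, ‖a s‖ ^ 2 ≤ ∑ s ∈ Finset.Icc 1 t, (1 : ℝ) :=
      Finset.sum_le_sum fun s hs =>
        pow_le_one₀ (norm_nonneg _) (ha s (Finset.Icc_subset_Icc_right htT hs))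
    have h2 : (t : ℝ) ≤ T := by exact_mod_cast htT
    simp at h1
    linarith
  rw [hdet, Real.log_prod (fun i _ => (hpos i).ne')]
  set m : ℝ := 1 + T / d with hm
  have hm0 : 0 < m := by positivity
  -- Tangent line of log at m = 1 + T/d, which bounds the mean eigenvalue; summing gives the AM–GM
  -- bound on the determinant.
  have h : ∀ i, Real.log (hH.eigenvalues i) ≤ Real.log m + (hH.eigenvalues i / m - 1) := by
    intro i
    have := Real.log_le_sub_one_of_pos (div_pos (hpos i) hm0)
    rw [Real.log_div (hpos i).ne' hm0.ne'] at this
    linarith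
  refine (Finset.sum_le_sum fun i _ => h i).trans ?_
  rw [Finset.sum_add_distrib, Finset.sum_sub_distrib, ← Finset.sum_div]
  simp only [Finset.sum_const, Finset.card_univ, Fintype.card_fin, nsmul_eq_mul, mul_one]
  have : (∑ i, hH.eigenvalues i) / m ≤ d := by
    rw [div_le_iff₀ hm0, hm, mul_add, mul_one, mul_div_cancel₀ _ hd0.ne']
    exact htr
  linarith

/-! ### The one-step method of mixtures -/

/-- Gaussian mixtures of exponential tilts, in closed form. -/
theorem lintegral_gaussian_mixture (U Y : ℝ) {w : ℝ} (hw : 0 ≤ w) :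
    ∫⁻ x, ENNReal.ofReal (gaussianPDFReal 0 1 x *
        Real.exp ((U + √w * x) * Y - (U + √w * x) ^ 2 / 2)) =
      ENNReal.ofReal (Real.exp ((2 * Y * U + Y ^ 2 * w - U ^ 2) / (2 * (1 + w))) / √(1 + w)) := by
  -- Mean and variance obtained by completing the square in x.
  set m : ℝ := √w * (Y - U) / (1 + w) with hm
  set v : NNReal := ⟨1 / (1 + w), by positivity⟩ with hv
  have hv' : (v : ℝ) = 1 / (1 + w) := rfl
  have hv0 : v ≠ 0 := by
    intro h
    have : (v : ℝ) = 0 := by rw [h]; rfl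
    rw [hv'] at this
    have : 0 < 1 / (1 + w) := by positivity
    linarith
  have hw1 : 0 < 1 + w := by linarith
  have hsq : √w ^ 2 = w := Real.sq_sqrt hw
  have h : ∀ x, gaussianPDFReal 0 1 x * Real.exp ((U + √w * x) * Y - (U + √w * x) ^ 2 / 2) =
      Real.exp ((2 * Y * U + Y ^ 2 * w - U ^ 2) / (2 * (1 + w))) / √(1 + w) *
        gaussianPDFReal m v x := by
    intro x
    simp only [gaussianPDFReal, hv', NNReal.coe_one, mul_one, sub_zero]
    have e1 : √(2 * Real.pi * (1 / (1 + w))) = √(2 * Real.pi) / √(1 + w) := by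
      rw [mul_one_div, Real.sqrt_div (by positivity)]
    rw [e1, mul_assoc, ← Real.exp_add]
    have e2 : -x ^ 2 / 2 + ((U + √w * x) * Y - (U + √w * x) ^ 2 / 2) =
        (2 * Y * U + Y ^ 2 * w - U ^ 2) / (2 * (1 + w)) + -(x - m) ^ 2 / (2 * (1 / (1 + w))) := by
      have e3 : (x - m) ^ 2 = x ^ 2 - 2 * x * (√w * (Y - U)) / (1 + w) +
          w * (Y - U) ^ 2 / (1 + w) ^ 2 := by
        rw [hm]
        field_simp
        linear_combination (Y - U) ^ 2 * hsq
      rw [e3]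
      have e4 : (U + √w * x) ^ 2 = U ^ 2 + 2 * U * √w * x + w * x ^ 2 := by
        rw [add_sq, mul_pow, hsq]; ring
      rw [e4]
      field_simp
      ring
    rw [e2, Real.exp_add]
    have : √(1 + w) ≠ 0 := by positivity
    have : √(2 * Real.pi) ≠ 0 := by positivity
    field_simp
  simp_rw [h]
  rw [lintegral_congr fun x => ENNReal.ofReal_mul (by positivity), lintegral_const_mul _
    (by fun_prop), lintegral_gaussianPDFReal_eq_one m hv0, mul_one]

/-- One-dimensional method of mixtures. -/
theorem lintegral_exp_quadratic_le (ν : Measure ℝ) [IsProbabilityMeasure ν] {σ : ℝ} (hσ : 0 < σ)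
    (hν : ∀ l : ℝ, ∫⁻ y, ENNReal.ofReal (Real.exp (l * y)) ∂ν ≤
      ENNReal.ofReal (Real.exp (σ ^ 2 * l ^ 2 / 2))) (u : ℝ) {w : ℝ} (hw : 0 ≤ w) :
    ∫⁻ y, ENNReal.ofReal (Real.exp ((2 * y * u + y ^ 2 * w - u ^ 2) / (1 + w) / (2 * σ ^ 2))) ∂ν ≤
      ENNReal.ofReal √(1 + w) := by
  have hw1 : 0 < √(1 + w) := Real.sqrt_pos.2 (by linarith)
  have h1 : ∀ y, ENNReal.ofReal (Real.exp ((2 * y * u + y ^ 2 * w - u ^ 2) / (1 + w) / (2 * σ ^ 2)))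
      = ENNReal.ofReal √(1 + w) * ∫⁻ x, ENNReal.ofReal (gaussianPDFReal 0 1 x *
        Real.exp ((u / σ + √w * x) * (y / σ) - (u / σ + √w * x) ^ 2 / 2)) := by
    intro y
    rw [lintegral_gaussian_mixture _ _ hw, ← ENNReal.ofReal_mul hw1.le]
    congr 1
    rw [mul_div_cancel₀ _ hw1.ne']
    congr 1
    field_simp
  simp_rw [h1]
  -- After Tonelli, each tilt has integral at most 1 by the sub-Gaussian bound, so the Gaussian
  -- average is at most 1.
  rw [lintegral_const_mul' _ _ ENNReal.ofReal_ne_top, lintegral_lintegral_swap]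
  · refine mul_le_of_le_one_right' ?_
    rw [← lintegral_gaussianPDFReal_eq_one 0 one_ne_zero]
    refine lintegral_mono fun x => ?_
    have h2 : ∀ y, ENNReal.ofReal (gaussianPDFReal 0 1 x *
        Real.exp ((u / σ + √w * x) * (y / σ) - (u / σ + √w * x) ^ 2 / 2)) =
        ENNReal.ofReal (gaussianPDFReal 0 1 x * Real.exp (-((u / σ + √w * x) ^ 2 / 2))) *
          ENNReal.ofReal (Real.exp ((u / σ + √w * x) / σ * y)) := by
      intro y
      rw [← ENNReal.ofReal_mul (mul_nonneg (gaussianPDFReal_nonneg _ _ _) (Real.exp_nonneg _)),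
        mul_assoc, ← Real.exp_add]
      congr 3
      ring
    simp_rw [h2]
    rw [lintegral_const_mul' _ _ ENNReal.ofReal_ne_top]
    refine (mul_le_mul_right (hν _) _).trans ?_
    rw [← ENNReal.ofReal_mul (mul_nonneg (gaussianPDFReal_nonneg _ _ _) (Real.exp_nonneg _)),
      mul_assoc, ← Real.exp_add]
    apply le_of_eq
    congr 1
    have : -((u / σ + √w * x) ^ 2 / 2) + σ ^ 2 * ((u / σ + √w * x) / σ) ^ 2 / 2 = 0 := by
      rw [div_pow, mul_div_cancel₀ _ (by positivity)]
      ring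
    rw [this, Real.exp_zero, mul_one]
  · apply Measurable.aemeasurable
    simp only [Function.uncurry_def]
    have := measurable_gaussianPDFReal 0 1
    fun_prop

section ConditionalStep

variable {Ω β : Type*} [mΩ : MeasurableSpace Ω] [mβ : MeasurableSpace β] {P : Measure Ω}
  [IsProbabilityMeasure P] {X : Ω → β} {ε : Ω → ℝ} {σ : ℝ}

/-- The hypothesis has one null set per l. Passing to rational l in the regular conditional law
leaves a single null set for all l, which integration over random tilts requires. -/
theorem condDistrib_hasSubgaussianMGF (hX : Measurable X) (hε : Measurable ε)
    (hint : ∀ l : ℝ, Integrable (fun ω => Real.exp (l * ε ω)) P)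
    (hsub : ∀ l : ℝ, P[fun ω => Real.exp (l * ε ω) | mβ.comap X] ≤ᵐ[P]
      fun _ => Real.exp (σ ^ 2 * l ^ 2 / 2)) :
    Kernel.HasSubgaussianMGF id ⟨σ ^ 2, sq_nonneg σ⟩ (condDistrib ε X P) (P.map X) := by
  refine .of_rat (fun l => ?_) fun q => ?_
  · rw [condDistrib_comp_map hX.aemeasurable hε.aemeasurable,
      integrable_map_measure (by fun_prop) hε.aemeasurable]
    exact hint l
  · have hm : Measurable fun b => mgf id (condDistrib ε X P b) q :=
      (StronglyMeasurable.integral_condDistrib (f := fun p : β × ℝ => Real.exp (q * p.2))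
        (Measurable.stronglyMeasurable (by fun_prop))).measurable
    rw [ae_map_iff hX.aemeasurable (measurableSet_le hm measurable_const)]
    have h := condExp_ae_eq_integral_condDistrib hX hε.aemeasurable
      (f := fun y : ℝ => Real.exp (q * y)) (Measurable.stronglyMeasurable (by fun_prop)) (hint q)
    filter_upwards [h, hsub q] with ω h1 h2
    rw [h1] at h2
    exact h2

theorem lintegral_step_le (hX : Measurable X) (hε : Measurable ε) (hσ : 0 < σ)
    (hint : ∀ l : ℝ, Integrable (fun ω => Real.exp (l * ε ω)) P)
    (hsub : ∀ l : ℝ, P[fun ω => Real.exp (l * ε ω) | mβ.comap X] ≤ᵐ[P]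
      fun _ => Real.exp (σ ^ 2 * l ^ 2 / 2))
    {u w : β → ℝ} (hu : Measurable u) (hw : Measurable w) (hw0 : ∀ b, 0 ≤ w b)
    {F : β → ENNReal} (hF : Measurable F) :
    ∫⁻ ω, F (X ω) * ENNReal.ofReal (Real.exp ((2 * ε ω * u (X ω) + ε ω ^ 2 * w (X ω) - u (X ω) ^ 2) /
        (1 + w (X ω)) / (2 * σ ^ 2))) ∂P ≤
      ∫⁻ ω, F (X ω) * ENNReal.ofReal √(1 + w (X ω)) ∂P := by
  have hk := condDistrib_hasSubgaussianMGF hX hε hint hsub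
  set G : β × ℝ → ENNReal := fun p => F p.1 * ENNReal.ofReal (Real.exp
    ((2 * p.2 * u p.1 + p.2 ^ 2 * w p.1 - u p.1 ^ 2) / (1 + w p.1) / (2 * σ ^ 2))) with hG
  have hGm : Measurable G := by fun_prop
  have h1 : ∫⁻ ω, G (X ω, ε ω) ∂P =
      ∫⁻ b, ∫⁻ y, G (b, y) ∂(condDistrib ε X P b) ∂(P.map X) := by
    rw [← Measure.lintegral_compProd hGm, compProd_map_condDistrib hε.aemeasurable,
      lintegral_map hGm (hX.prodMk hε)]
  change ∫⁻ ω, G (X ω, ε ω) ∂P ≤ _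
  rw [h1, ← lintegral_map (f := fun b => F b * ENNReal.ofReal √(1 + w b)) (by fun_prop) hX]
  refine lintegral_mono_ae ?_
  filter_upwards [hk.mgf_le, hk.ae_forall_integrable_exp_mul] with b hb hbi
  rw [hG]
  simp only
  rw [lintegral_const_mul _ (by fun_prop)]
  gcongr
  refine lintegral_exp_quadratic_le _ hσ (fun l => ?_) _ (hw0 b)
  change ∫⁻ y, ENNReal.ofReal (Real.exp (l * id y)) ∂_ ≤ _
  rw [← ofReal_integral_eq_lintegral_ofReal (hbi l) (ae_of_all _ fun y => Real.exp_nonneg _)]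
  exact ENNReal.ofReal_le_ofReal (hb l)

end ConditionalStep

/-- `lintegral_step_le` for a sub-σ-algebra. -/
theorem lintegral_step_le' {Ω : Type*} {m mΩ : MeasurableSpace Ω} (hm : m ≤ mΩ) {P : Measure Ω}
    [IsProbabilityMeasure P] {ε : Ω → ℝ} {σ : ℝ} (hε : Measurable ε) (hσ : 0 < σ)
    (hint : ∀ l : ℝ, Integrable (fun ω => Real.exp (l * ε ω)) P)
    (hsub : ∀ l : ℝ, P[fun ω => Real.exp (l * ε ω) | m] ≤ᵐ[P]
      fun _ => Real.exp (σ ^ 2 * l ^ 2 / 2))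
    {u w : Ω → ℝ} (hu : Measurable[m] u) (hw : Measurable[m] w) (hw0 : ∀ b, 0 ≤ w b)
    {F : Ω → ENNReal} (hF : Measurable[m] F) :
    ∫⁻ ω, F ω * ENNReal.ofReal (Real.exp ((2 * ε ω * u ω + ε ω ^ 2 * w ω - u ω ^ 2) /
        (1 + w ω) / (2 * σ ^ 2))) ∂P ≤
      ∫⁻ ω, F ω * ENNReal.ofReal √(1 + w ω) ∂P := by
  -- Conditioning on `m` is conditioning on the identity map into Ω equipped with `m`; Ω need not be
  -- standard Borel, because the disintegrated variable is real.
  have hX : @Measurable Ω Ω mΩ m id := measurable_id'' hm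
  refine @lintegral_step_le Ω Ω mΩ m P _ id ε σ hX hε hσ hint ?_ u w hu hw hw0 F hF
  rw [MeasurableSpace.comap_id]
  exact hsub

/-! ### Ville's inequality -/

section Ville

variable {Ω : Type*} {mΩ : MeasurableSpace Ω}

open Classical in
/-- The process `M` frozen at the first time it exceeds the level `K`. -/
noncomputable def frozen (M : ℕ → Ω → ENNReal) (K : ENNReal) : ℕ → Ω → ENNReal
  | 0 => M 0
  | t + 1 => fun ω => if K < frozen M K t ω then frozen M K t ω else M (t + 1) ω

theorem frozen_succ_of_lt {M : ℕ → Ω → ENNReal} {K : ENNReal} {t : ℕ} {ω : Ω}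
    (h : K < frozen M K t ω) : frozen M K (t + 1) ω = frozen M K t ω := by
  simp only [frozen]
  exact if_pos h

theorem frozen_succ_of_not_lt {M : ℕ → Ω → ENNReal} {K : ENNReal} {t : ℕ} {ω : Ω}
    (h : ¬ K < frozen M K t ω) : frozen M K (t + 1) ω = M (t + 1) ω := by
  simp only [frozen]
  exact if_neg h

theorem le_of_frozen_le {M : ℕ → Ω → ENNReal} {K : ENNReal} {t : ℕ} {ω : Ω}
    (h : frozen M K t ω ≤ K) : frozen M K t ω = M t ω ∧ ∀ s ≤ t, M s ω ≤ K := by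
  induction t with
  | zero =>
    refine ⟨rfl, fun s hs => ?_⟩
    rw [Nat.le_zero.1 hs]
    exact h
  | succ t ih =>
    by_cases hc : K < frozen M K t ω
    · rw [frozen_succ_of_lt hc] at h
      exact absurd hc (not_lt.2 h)
    · have h1 : frozen M K (t + 1) ω = M (t + 1) ω := frozen_succ_of_not_lt hc
      refine ⟨h1, fun s hs => ?_⟩
      rcases Nat.le_succ_iff.1 hs with h2 | rfl
      · exact (ih (not_lt.1 hc)).2 s h2
      · rw [← h1]; exact h

/-- Ville's maximal inequality over a finite horizon, in strict form. -/
theorem exists_event_of_supermartingale {P : Measure Ω} [IsProbabilityMeasure P] {T : ℕ}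
    {M : ℕ → Ω → ENNReal} {ℱ : ℕ → MeasurableSpace Ω} (hmono : Monotone ℱ)
    (hle : ∀ t ≤ T, ℱ t ≤ mΩ) (hM : ∀ t ≤ T, Measurable[ℱ t] (M t)) (h0 : ∫⁻ ω, M 0 ω ∂P ≤ 1)
    (hsuper : ∀ t < T, ∀ A, MeasurableSet[ℱ t] A → ∫⁻ ω in A, M (t + 1) ω ∂P ≤ ∫⁻ ω in A, M t ω ∂P)
    {K : ENNReal} (hK0 : K ≠ 0) (hK : K ≠ ⊤) :
    ∃ E, MeasurableSet E ∧ P Eᶜ < K⁻¹ ∧ ∀ ω ∈ E, ∀ t ≤ T, M t ω ≤ K := by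
  have hmeas : ∀ t ≤ T, Measurable[ℱ t] (frozen M K t) := by
    intro t
    induction t with
    | zero => exact fun h => hM 0 h
    | succ t ih =>
      intro ht
      have h1 : Measurable[ℱ (t + 1)] (frozen M K t) :=
        (ih (by omega)).mono (hmono (Nat.le_succ t)) le_rfl
      exact Measurable.ite (measurableSet_lt measurable_const h1) h1 (hM (t + 1) ht)
  have hint : ∀ t ≤ T, ∫⁻ ω, frozen M K t ω ∂P ≤ 1 := by
    intro t
    induction t with
    | zero => exact fun _ => h0
    | succ t ih =>
      intro ht
      refine le_trans ?_ (ih (by omega))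
      -- On this set the frozen process does not move; off it, it coincides with M at both times and
      -- the supermartingale property applies.
      have hA : MeasurableSet[ℱ t] {ω | K < frozen M K t ω} :=
        measurableSet_lt measurable_const (hmeas t (by omega))
      have hA' : MeasurableSet {ω | K < frozen M K t ω} := hle t (by omega) _ hA
      rw [← lintegral_add_compl (frozen M K (t + 1)) hA', ← lintegral_add_compl (frozen M K t) hA']
      gcongr ?_ + ?_
      · refine le_of_eq (setLIntegral_congr_fun hA' fun ω hω => ?_)
        exact frozen_succ_of_lt hω
      · calc _ = ∫⁻ ω in {ω | K < frozen M K t ω}ᶜ, M (t + 1) ω ∂P :=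
              setLIntegral_congr_fun hA'.compl fun ω hω => frozen_succ_of_not_lt hω
          _ ≤ ∫⁻ ω in {ω | K < frozen M K t ω}ᶜ, M t ω ∂P := hsuper t (by omega) _ hA.compl
          _ = _ := setLIntegral_congr_fun hA'.compl fun ω hω =>
              (le_of_frozen_le (not_lt.1 hω)).1.symm
  have hT := (hmeas T le_rfl).mono (hle T le_rfl) le_rfl
  have hE : MeasurableSet {ω | frozen M K T ω ≤ K} := measurableSet_le hT measurable_const
  refine ⟨_, hE, ?_, fun ω hω => (le_of_frozen_le hω).2⟩
  by_cases hP : P {ω | frozen M K T ω ≤ K}ᶜ = 0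
  · rw [hP]
    exact ENNReal.inv_pos.2 hK
  -- The frozen process strictly exceeds K on a set of positive measure, so the integrals differ
  -- strictly; this makes the final probability strictly greater than 1 - 1/T.
  · have h1 : ∫⁻ _ in {ω | frozen M K T ω ≤ K}ᶜ, K ∂P <
        ∫⁻ ω in {ω | frozen M K T ω ≤ K}ᶜ, frozen M K T ω ∂P := by
      refine setLIntegral_strict_mono hE.compl hP hT ?_ (ae_of_all _ fun ω hω => not_le.1 hω)
      rw [setLIntegral_const]
      exact ENNReal.mul_ne_top hK (measure_ne_top _ _)
    rw [setLIntegral_const] at h1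
    have h2 := (h1.trans_le (setLIntegral_le_lintegral _ _)).trans_le (hint T le_rfl)
    rw [← one_div, ENNReal.lt_div_iff_mul_lt (Or.inl hK0) (Or.inl hK), mul_comm]
    exact h2

end Ville

/-! ### The mixture supermartingale and its measurability -/

/-- The mixture supermartingale `exp (‖S_t‖²_{Λ_t⁻¹} / (2 σ²)) / √(det Λ_t)`. -/
noncomputable def mixture {d : ℕ} (σ : ℝ) (a : ℕ → Vec d) (ε : ℕ → ℝ) (t : ℕ) : ℝ :=
  Real.exp (quad a t (noiseSum a ε t) / (2 * σ ^ 2)) / √(cov a t).det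

theorem mixture_pos {d : ℕ} (σ : ℝ) (a : ℕ → Vec d) (ε : ℕ → ℝ) (t : ℕ) :
    0 < mixture σ a ε t :=
  div_pos (Real.exp_pos _) (Real.sqrt_pos.2 (cov_posDef a t).det_pos)

theorem mixture_zero {d : ℕ} (σ : ℝ) (a : ℕ → Vec d) (ε : ℕ → ℝ) : mixture σ a ε 0 = 1 := by
  simp [mixture, noiseSum, quad, cov]

theorem mixture_succ {d : ℕ} (σ : ℝ) (a : ℕ → Vec d) (ε : ℕ → ℝ) (t : ℕ) :
    mixture σ a ε (t + 1) = mixture σ a ε t / √(1 + quad a t (a (t + 1))) *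
      Real.exp ((2 * ε (t + 1) * inner ℝ (a (t + 1)) (covInv a t (noiseSum a ε t)) +
        ε (t + 1) ^ 2 * quad a t (a (t + 1)) -
        (inner ℝ (a (t + 1)) (covInv a t (noiseSum a ε t))) ^ 2) /
        (1 + quad a t (a (t + 1))) / (2 * σ ^ 2)) := by
  rw [mixture, mixture, quad_noiseSum_succ, det_cov_succ, add_div, Real.exp_add,
    Real.sqrt_mul (cov_posDef a t).det_pos.le]
  ring

section Measurability

variable {Ω : Type*} {d : ℕ} {m : MeasurableSpace Ω} {a : ℕ → Ω → Vec d} {ε : ℕ → Ω → ℝ}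

/-- The Sherman–Morrison recursion builds Λ⁻¹x from inner products and scalar multiples only. -/
theorem measurable_covInv {t : ℕ} (ha : ∀ s ∈ Finset.Icc 1 t, Measurable (a s)) {x : Ω → Vec d}
    (hx : Measurable x) : Measurable fun ω => covInv (fun s => a s ω) t (x ω) := by
  induction t generalizing x with
  | zero => simpa only [covInv_zero] using hx
  | succ t ih =>
    have ih' := fun {x : Ω → Vec d} => @ih
      (fun s hs => ha s (Finset.Icc_subset_Icc_right (Nat.le_succ t) hs)) x
    have hat := ha (t + 1) (by simp)
    simp only [covInv_succ]
    have h1 := ih' hx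
    have h2 := ih' hat
    have hk : Measurable fun ω => (inner ℝ (a (t + 1) ω) (covInv (fun s => a s ω) t (x ω)) : ℝ) /
        (1 + inner ℝ (a (t + 1) ω) (covInv (fun s => a s ω) t (a (t + 1) ω))) :=
      (hat.inner h1).div (measurable_const.add (hat.inner h2))
    exact h1.sub (hk.smul h2)

theorem measurable_quad {t : ℕ} (ha : ∀ s ∈ Finset.Icc 1 t, Measurable (a s)) {x : Ω → Vec d}
    (hx : Measurable x) : Measurable fun ω => quad (fun s => a s ω) t (x ω) :=
  hx.inner (measurable_covInv ha hx)

theorem measurable_det_cov {t : ℕ} (ha : ∀ s ∈ Finset.Icc 1 t, Measurable (a s)) :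
    Measurable fun ω => (cov (fun s => a s ω) t).det := by
  induction t with
  | zero => simp [cov]
  | succ t ih =>
    have ha' := fun s hs => ha s (Finset.Icc_subset_Icc_right (Nat.le_succ t) hs)
    simp only [det_cov_succ]
    exact (ih ha').mul (measurable_const.add (measurable_quad ha' (ha (t + 1) (by simp))))

theorem measurable_noiseSum {t : ℕ} (ha : ∀ s ∈ Finset.Icc 1 t, Measurable (a s))
    (hε : ∀ s ∈ Finset.Icc 1 t, Measurable (ε s)) :
    Measurable fun ω => noiseSum (fun s => a s ω) (fun s => ε s ω) t :=
  Finset.measurable_fun_sum _ fun s hs => (hε s hs).smul (ha s hs)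

theorem measurable_mixture (σ : ℝ) {t : ℕ} (ha : ∀ s ∈ Finset.Icc 1 t, Measurable (a s))
    (hε : ∀ s ∈ Finset.Icc 1 t, Measurable (ε s)) :
    Measurable fun ω => mixture σ (fun s => a s ω) (fun s => ε s ω) t := by
  unfold mixture
  exact ((measurable_quad ha (measurable_noiseSum ha hε)).div_const _).exp.div
    (measurable_det_cov ha).sqrt

end Measurability

/-! ### The confidence event -/

section History

variable {Ω : Type*} {d : ℕ} {a : ℕ → Ω → Vec d} {r : ℕ → Ω → ℝ}

theorem hist_mono (a : ℕ → Ω → Vec d) (r : ℕ → Ω → ℝ) : Monotone (hist a r) := by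
  intro s t hst
  exact biSup_mono fun i hi => Finset.Icc_subset_Icc_right hst hi

theorem measurable_action_hist {s t : ℕ} (hs : s ∈ Finset.Icc 1 t) :
    Measurable[hist a r t] (a s) := by
  refine Measurable.of_comap_le (le_trans le_sup_left
    (le_iSup₂ (f := fun s (_ : s ∈ Finset.Icc 1 t) => MeasurableSpace.comap (a s) inferInstance ⊔
      MeasurableSpace.comap (r s) inferInstance) s hs))

theorem measurable_reward_hist {s t : ℕ} (hs : s ∈ Finset.Icc 1 t) :
    Measurable[hist a r t] (r s) := by
  refine Measurable.of_comap_le (le_trans le_sup_right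
    (le_iSup₂ (f := fun s (_ : s ∈ Finset.Icc 1 t) => MeasurableSpace.comap (a s) inferInstance ⊔
      MeasurableSpace.comap (r s) inferInstance) s hs))

theorem measurable_noise_hist (θ : Vec d) {s t : ℕ} (hs : s ∈ Finset.Icc 1 t) :
    Measurable[hist a r t] (noise θ a r s) :=
  (measurable_reward_hist hs).sub ((measurable_action_hist hs).inner measurable_const)

end History

section Confidence

variable {Ω : Type*} [mΩ : MeasurableSpace Ω] {P : Measure Ω}
  {d T : ℕ} {β σ : ℝ} {θ e : Vec d} {a : ℕ → Ω → Vec d} {r : ℕ → Ω → ℝ}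

theorem hist_le (h : IsRun P T β σ θ e a r) {t : ℕ} (ht : t ≤ T) : hist a r t ≤ mΩ := by
  refine iSup₂_le fun s hs => sup_le ?_ ?_
  · exact (h.measurable_action s (Finset.Icc_subset_Icc_right ht hs)).comap_le
  · exact (h.measurable_reward s (Finset.Icc_subset_Icc_right ht hs)).comap_le

variable [IsProbabilityMeasure P]

/-- By `mixture_succ` the new value is an `m`-measurable factor M_t/√(1+w) times the one-step
exponential, whose conditional mean is at most √(1+w), cancelling the determinant growth. -/
theorem setLIntegral_mixture_succ_le_of_le {m : MeasurableSpace Ω} (hm : m ≤ mΩ)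
    {ε : ℕ → Ω → ℝ} {t : ℕ} (ha : ∀ s ∈ Finset.Icc 1 t, Measurable[m] (a s))
    (hε : ∀ s ∈ Finset.Icc 1 t, Measurable[m] (ε s)) (hat : Measurable[m] (a (t + 1)))
    (hεt : Measurable[mΩ] (ε (t + 1))) (hσ : 0 < σ)
    (hint : ∀ l : ℝ, Integrable (fun ω => Real.exp (l * ε (t + 1) ω)) P)
    (hsub : ∀ l : ℝ, P[fun ω => Real.exp (l * ε (t + 1) ω) | m] ≤ᵐ[P]
      fun _ => Real.exp (σ ^ 2 * l ^ 2 / 2))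
    {A : Set Ω} (hA : MeasurableSet[m] A) :
    ∫⁻ ω in A, ENNReal.ofReal (mixture σ (fun s => a s ω) (fun s => ε s ω) (t + 1)) ∂P ≤
      ∫⁻ ω in A, ENNReal.ofReal (mixture σ (fun s => a s ω) (fun s => ε s ω) t) ∂P := by
  have hu : Measurable[m] fun ω => (inner ℝ (a (t + 1) ω) (covInv (fun s => a s ω) t
      (noiseSum (fun s => a s ω) (fun s => ε s ω) t)) : ℝ) :=
    hat.inner (measurable_covInv ha (measurable_noiseSum ha hε))
  have hw : Measurable[m] fun ω => quad (fun s => a s ω) t (a (t + 1) ω) :=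
    measurable_quad ha hat
  have hM := measurable_mixture σ ha hε
  have hF : Measurable[m] (A.indicator fun ω => ENNReal.ofReal
      (mixture σ (fun s => a s ω) (fun s => ε s ω) t /
        √(1 + quad (fun s => a s ω) t (a (t + 1) ω)))) :=
    (hM.div (measurable_const.add hw).sqrt).ennreal_ofReal.indicator hA
  have hstep := lintegral_step_le' hm hεt hσ hint hsub hu hw (fun ω => quad_nonneg _ _ _) hF
  rw [← lintegral_indicator (hm A hA), ← lintegral_indicator (hm A hA)]
  refine le_trans (le_of_eq (lintegral_congr fun ω => ?_))
    (hstep.trans (le_of_eq (lintegral_congr fun ω => ?_)))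
  · by_cases hω : ω ∈ A
    · rw [Set.indicator_of_mem hω, Set.indicator_of_mem hω, mixture_succ, ENNReal.ofReal_mul]
      exact div_nonneg (mixture_pos _ _ _ _).le (Real.sqrt_nonneg _)
    · simp [Set.indicator_of_notMem hω]
  · by_cases hω : ω ∈ A
    · have hq := quad_nonneg (fun s => a s ω) t (a (t + 1) ω)
      have hs : √(1 + quad (fun s => a s ω) t (a (t + 1) ω)) ≠ 0 := by positivity
      rw [Set.indicator_of_mem hω, Set.indicator_of_mem hω, ← ENNReal.ofReal_mul
        (div_nonneg (mixture_pos _ _ _ _).le (Real.sqrt_nonneg _)), div_mul_cancel₀ _ hs]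
    · simp [Set.indicator_of_notMem hω]

theorem setLIntegral_mixture_succ_le (h : IsRun P T β σ θ e a r) (hσ : 0 < σ) {t : ℕ} (ht : t < T)
    {A : Set Ω} (hA : MeasurableSet[hist a r t] A) :
    ∫⁻ ω in A, ENNReal.ofReal (mixture σ (fun s => a s ω) (fun s => noise θ a r s ω) (t + 1)) ∂P ≤
      ∫⁻ ω in A, ENNReal.ofReal (mixture σ (fun s => a s ω) (fun s => noise θ a r s ω) t) ∂P := by
  have ht1 : t + 1 ∈ Finset.Icc 1 T := Finset.mem_Icc.2 ⟨by omega, by omega⟩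
  have hpred := h.predictable (t + 1) ht1
  have hsub := h.noise_subgaussian (t + 1) ht1
  rw [Nat.add_sub_cancel] at hpred hsub
  exact setLIntegral_mixture_succ_le_of_le (hist_le h ht.le) (ε := noise θ a r)
    (fun s hs => measurable_action_hist hs) (fun s hs => measurable_noise_hist θ hs) hpred
    ((h.measurable_reward _ ht1).sub ((h.measurable_action _ ht1).inner measurable_const)) hσ
    (h.noise_exp_integrable _ ht1) hsub hA

/-- The bounds at l = ±1 give E[e^ε + e^(-ε) - 2] ≤ 0, while the integrand is the square of e^(ε/2)
- e^(-ε/2). -/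
theorem noise_eq_zero_ae (h : IsRun P T β 0 θ e a r) {t : ℕ} (ht : t ∈ Finset.Icc 1 T) :
    ∀ᵐ ω ∂P, noise θ a r t ω = 0 := by
  have hle : hist a r (t - 1) ≤ mΩ := hist_le h (by have := Finset.mem_Icc.1 ht; omega)
  have h1 : ∀ l : ℝ, ∫ ω, Real.exp (l * noise θ a r t ω) ∂P ≤ 1 := by
    intro l
    rw [← integral_condExp hle]
    have := integral_mono_ae integrable_condExp (integrable_const _) (h.noise_subgaussian t ht l)
    simpa using this
  have hi := h.noise_exp_integrable t ht
  set f : Ω → ℝ := fun ω => Real.exp (1 * noise θ a r t ω) + Real.exp (-1 * noise θ a r t ω) - 2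
    with hf
  have hfi : Integrable f P := ((hi 1).add (hi (-1))).sub (integrable_const _)
  have hfe : ∀ ω, f ω = (Real.exp (noise θ a r t ω / 2) - Real.exp (-(noise θ a r t ω / 2))) ^ 2 := by
    intro ω
    rw [sub_sq, ← Real.exp_nat_mul, ← Real.exp_nat_mul, mul_assoc, ← Real.exp_add]
    simp only [hf, add_neg_cancel, Real.exp_zero]
    rw [show ((2 : ℕ) : ℝ) * (noise θ a r t ω / 2) = 1 * noise θ a r t ω by push_cast; ring,
      show ((2 : ℕ) : ℝ) * -(noise θ a r t ω / 2) = -1 * noise θ a r t ω by push_cast; ring]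
    ring
  have hf0 : 0 ≤ f := fun ω => by rw [hfe]; exact sq_nonneg _
  have hint : ∫ ω, f ω ∂P = 0 := by
    refine le_antisymm ?_ (integral_nonneg hf0)
    have h2 : ∫ ω, f ω ∂P = ∫ ω, Real.exp (1 * noise θ a r t ω) ∂P +
        ∫ ω, Real.exp (-1 * noise θ a r t ω) ∂P - 2 := by
      have h3 : ∫ ω, f ω ∂P =
          ∫ ω, Real.exp (1 * noise θ a r t ω) + Real.exp (-1 * noise θ a r t ω) ∂P - ∫ _, 2 ∂P :=
        integral_sub ((hi 1).add (hi (-1))) (integrable_const _)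
      rw [h3, integral_add (hi 1) (hi (-1))]
      simp
    rw [h2]
    linarith [h1 1, h1 (-1)]
  filter_upwards [(integral_eq_zero_iff_of_nonneg hf0 hfi).1 hint] with ω hω
  rw [hfe, Pi.zero_apply, sq_eq_zero_iff, sub_eq_zero] at hω
  have := Real.exp_injective hω
  linarith

/-- The self-normalized concentration inequality behind the confidence ellipsoid. -/
theorem exists_confidence_event (hd : 1 ≤ d) (hT : 1 ≤ T) (hσ : 0 ≤ σ)
    (h : IsRun P T β σ θ e a r) :
    ∃ E : Set Ω, MeasurableSet E ∧ 1 - 1 / (T : ℝ) < P.real E ∧ ∀ ω ∈ E, ∀ t ≤ T,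
      quad (fun s => a s ω) t (noiseSum (fun s => a s ω) (fun s => noise θ a r s ω) t) ≤
        σ ^ 2 * (d * Real.log (1 + T / d) + 2 * Real.log T) := by
  have hT0 : (0 : ℝ) < T := by exact_mod_cast hT
  -- The mixture divides by σ², so σ = 0 is treated apart: the noise vanishes almost surely.
  rcases hσ.eq_or_lt with rfl | hσ0
  · refine ⟨⋂ t ∈ Finset.Icc 1 T, {ω | noise θ a r t ω = 0}, ?_, ?_, ?_⟩
    · refine Finset.measurableSet_biInter _ fun t ht => ?_
      have hm : Measurable (noise θ a r t) :=
        (h.measurable_reward _ ht).sub ((h.measurable_action _ ht).inner measurable_const)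
      exact hm (measurableSet_singleton 0)
    · have hae : ∀ᵐ ω ∂P, ω ∈ ⋂ t ∈ Finset.Icc 1 T, {ω | noise θ a r t ω = 0} := by
        simp only [Set.mem_iInter, Set.mem_ofPred_eq]
        rw [Finset.eventually_all]
        exact fun t ht => noise_eq_zero_ae h ht
      have h1 : P.real (⋂ t ∈ Finset.Icc 1 T, {ω | noise θ a r t ω = 0}) = 1 := by
        rw [measureReal_def, (measure_congr (Filter.eventuallyEq_univ.2 hae) :
          P (⋂ t ∈ Finset.Icc 1 T, {ω | noise θ a r t ω = 0}) = P Set.univ)]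
        simp
      rw [h1]
      have : 0 < 1 / (T : ℝ) := by positivity
      linarith
    · intro ω hω t ht
      simp only [Set.mem_iInter, Set.mem_ofPred_eq] at hω
      have h0 : noiseSum (fun s => a s ω) (fun s => noise θ a r s ω) t = 0 := by
        refine Finset.sum_eq_zero fun s hs => ?_
        simp only [hω s (Finset.Icc_subset_Icc_right ht hs), zero_smul]
      rw [h0]
      simp [quad]
  · obtain ⟨E, hE, hPE, hbound⟩ := exists_event_of_supermartingale (P := P) (T := T)
      (M := fun t ω => ENNReal.ofReal
        (mixture σ (fun s => a s ω) (fun s => noise θ a r s ω) t))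
      (hist_mono a r) (fun t ht => hist_le h ht)
      (fun t _ => (measurable_mixture σ (fun s hs => measurable_action_hist hs)
        (fun s hs => measurable_noise_hist θ hs)).ennreal_ofReal)
      (by simp [mixture_zero]) (fun t ht A hA => setLIntegral_mixture_succ_le h hσ0 ht hA)
      -- Level K = T gives failure probability below 1/T, and its logarithm is the source of 2 log T
      -- in the radius.
      (K := (T : ENNReal)) (by simp; omega) (by simp)
    refine ⟨E, hE, ?_, fun ω hω t ht => ?_⟩
    · have h1 : P.real Eᶜ < 1 / T := by
        rw [measureReal_def]
        have := (ENNReal.toReal_lt_toReal (measure_ne_top _ _)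
          (ENNReal.inv_ne_top.2 (by simp; omega))).2 hPE
        simpa using this
      rw [probReal_compl_eq_one_sub hE] at h1
      linarith
    · have h1 := hbound ω hω t ht
      rw [← ENNReal.ofReal_natCast, ENNReal.ofReal_le_ofReal_iff hT0.le] at h1
      have h2 := Real.log_le_log (mixture_pos _ _ _ _) h1
      have hdet := (cov_posDef (fun s => a s ω) t).det_pos
      rw [mixture, Real.log_div (Real.exp_pos _).ne' (Real.sqrt_pos.2 hdet).ne', Real.log_exp,
        Real.log_sqrt hdet.le] at h2
      have h3 := log_det_cov_le hd (fun s => a s ω) ht (fun s hs => h.action_mem s hs ω)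
      have h4 : quad (fun s => a s ω) t (noiseSum (fun s => a s ω) (fun s => noise θ a r s ω) t) /
          (2 * σ ^ 2) ≤ (d * Real.log (1 + T / d) + 2 * Real.log T) / 2 := by linarith
      rw [div_le_iff₀ (by positivity)] at h4
      linarith

end Confidence

end LinUCB

/-! ### Assembly -/

theorem proposition2 (κ : ℝ) (hκ : 0 < κ) :
    ∃ c > (0 : ℝ), ∃ C > (0 : ℝ),
      ∀ {Ω : Type*} [MeasurableSpace Ω] (P : Measure Ω) [IsProbabilityMeasure P]
        (d : ℕ) (_ : 2 ≤ d) (T : ℕ) (_ : 1 ≤ T) (σ : ℝ) (_ : 0 ≤ σ) (β : ℝ)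
        (_ : σ * √(d * Real.log (1 + T / d) + 2 * Real.log T) + 1 ≤ β)
        (θ : LinUCB.Vec d) (_ : ‖θ‖ = 1) (e : LinUCB.Vec d) (_ : ‖e‖ ≤ 1)
        (a : ℕ → Ω → LinUCB.Vec d) (r : ℕ → Ω → ℝ) (_ : LinUCB.IsRun P T β σ θ e a r),
        ∃ E : Set Ω, MeasurableSet E ∧ 1 - 1 / (T : ℝ) < P.real E ∧
          ∀ ω ∈ E, ∀ t : ℕ, κ * (β ^ 2 * d) ≤ t → t ≤ T →
            LinUCB.Comparable c C (LinUCB.eig (fun s => a s ω) t d)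
              (LinUCB.meanEig (fun s => a s ω) t) ∧
            LinUCB.Comparable c C (LinUCB.meanEig (fun s => a s ω) t) (β * √((t : ℝ) / d)) ∧
            ∀ v : LinUCB.Vec d, LinUCB.IsLeadingEigenvector θ (fun s => a s ω) t v →
              ‖v - θ‖ ≤ C * (β / √(LinUCB.eig (fun s => a s ω) t d)) := by
  obtain ⟨c, hc, C, hC, hspec⟩ := LinUCB.spectrum_of_isOptimistic hκ
  refine ⟨c, hc, C, hC, ?_⟩
  intro Ω _ P _ d hd T hT σ hσ β hβ θ hθ e he a r hrun
  obtain ⟨E, hE, hPE, hquad⟩ := LinUCB.exists_confidence_event (by omega) hT hσ hrun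
  have hβ1 : 1 ≤ β := by
    have : 0 ≤ σ * √(d * Real.log (1 + T / d) + 2 * Real.log T) := by positivity
    linarith
  refine ⟨E, hE, hPE, fun ω hω t ht htT => ?_⟩
  refine hspec d hd T β hβ1 θ hθ (fun s => a s ω) ?_ t ht htT
  refine LinUCB.isOptimistic_of_confidence (by omega) hβ1 hθ he
    (fun s hs => hrun.action_mem s hs ω) (fun s hs => hrun.action_max s hs ω) fun n hn => ?_
  have h1 := LinUCB.norm_ridge_sub_le (by omega) hθ (fun s => a s ω) (fun s => r s ω) n
    (Real.sqrt_le_sqrt (hquad ω hω n hn))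
  rw [Real.sqrt_mul (sq_nonneg σ), Real.sqrt_sq hσ] at h1
  refine h1.trans ?_
  gcongr
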